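/- Identify the square in the $i$th column from the left and the $j$th row from the bottom of an array with the pair $(i,j)$. A \emph{Ferrers board} $F$ is a finite set of squares such that $(i,j)\in F$, $i'\le i$ and $j'\le j$ imply $(i',j')\in F$. A \emph{rook placement} $P$ on $F$ is a subset of $F$ with at most one square in each row and in each column. Its \emph{inverse} is the placement $P'=\{(j,i):(i,j)\in P\}$ on the conjugate board $F'=\{(j,i):(i,j)\in F\}$, that is, the reflection of $P$ across the SW--NE diagonal. Fix an integer $k\ge 2$. An \emph{occurrence of $k\ldots 1$} in $P$ is a sequence of squares $(c_1,r_1),\ldots,(c_k,r_k)$ of $P$ with $c_1<\cdots<c_k$ and $r_1>\cdots>r_k$, all contained in one rectangular subboard of $F$. If $P$ has such an occurrence, let $(c_1,r_1),\ldots,(c_k,r_k)$ be the one whose sequence of rows $(r_1,\ldots,r_k)$ is lexicographically smallest, and let $\phi(P)$ be obtained from $P$ by replacing these squares by $(c_1,r_2),(c_2,r_3),\ldots,(c_{k-1},r_k),(c_k,r_1)$ and leaving all other squares fixed. Let $\phi^*(P)$ be the placement on $F$ obtained by applying $\phi$ repeatedly until no occurrence of $k\ldots 1$ remains (this happens after finitely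 many steps). \textbf{Corollary.} For every $k\ge 2$ and every (not necessarily full) rook placement $P$ on a Ferrers board $F$, $$\phi^*(P')=(\phi^*(P))',$$ where on the left $\phi^*$ is the map for placements on $F'$, and on the right the map for placements on $F$. -/

import Mathlib

/-- A rook placement on a Ferrers board `F`. A board is a finite lower set of pairs
`(i, j) : ℕ × ℕ`; here `(i, j)` is the square in column `i` (from the left) and row `j` (from the
bottom), both counted from `0`. -/
@[ext]
structure RookPlacement (F : YoungDiagram) where
  /-- the squares that carry a marker -/
  squares : Finset (ℕ × ℕ)
  subset : squares ⊆ F.cells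
  /-- at most one marker in each column -/
  col_unique : ∀ x ∈ squares, ∀ y ∈ squares, x.1 = y.1 → x = y
  /-- at most one marker in each row -/
  row_unique : ∀ x ∈ squares, ∀ y ∈ squares, x.2 = y.2 → x = y

namespace RookPlacement

variable {F : YoungDiagram}

/-- The inverse `P'`: the reflection of `P` across the SW-NE diagonal, a placement on the
conjugate board. -/
def inverse (P : RookPlacement F) : RookPlacement F.transpose where
  squares := P.squares.image Prod.swap
  subset := by
    intro x hx
    obtain ⟨y, hy, rfl⟩ := Finset.mem_image.1 hx
    have := P.subset hy
    rw [YoungDiagram.mem_cells] at this ⊢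
    simpa [YoungDiagram.mem_transpose] using this
  col_unique := by
    intro x hx y hy h
    obtain ⟨a, ha, rfl⟩ := Finset.mem_image.1 hx
    obtain ⟨b, hb, rfl⟩ := Finset.mem_image.1 hy
    rw [P.row_unique a ha b hb h]
  row_unique := by
    intro x hx y hy h
    obtain ⟨a, ha, rfl⟩ := Finset.mem_image.1 hx
    obtain ⟨b, hb, rfl⟩ := Finset.mem_image.1 hy
    rw [P.col_unique a ha b hb h]

/-- `s 0, …, s (k-1)` is an occurrence of the pattern `k … 1` in `P`: markers of `P`, listed from
left to right, going down, and all contained in one rectangular subboard of `F`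
(`Set.Icc p q` is the rectangle with southwest square `p` and northeast square `q`). -/
structure IsOccurrence (P : RookPlacement F) {k : ℕ} (s : Fin k → ℕ × ℕ) : Prop where
  mem : ∀ i, s i ∈ P.squares
  col_lt : ∀ i j, i < j → (s i).1 < (s j).1
  row_gt : ∀ i j, i < j → (s j).2 < (s i).2
  rect : ∃ p q : ℕ × ℕ, (∀ x ∈ Set.Icc p q, x ∈ F) ∧ ∀ i, s i ∈ Set.Icc p q

/-- `P` avoids `k … 1`. -/
def Avoids (P : RookPlacement F) (k : ℕ) : Prop :=
  ¬ ∃ s : Fin k → ℕ × ℕ, P.IsOccurrence s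

/-- `s` is the smallest occurrence of `k … 1` in `P`, for the lexicographic order on the
sequences of values, i.e. of row numbers read from left to right. -/
def IsSmallestOccurrence (P : RookPlacement F) {k : ℕ} (s : Fin k → ℕ × ℕ) : Prop :=
  P.IsOccurrence s ∧ ∀ t : Fin k → ℕ × ℕ, P.IsOccurrence t →
    toLex (fun i => (s i).2) ≤ toLex (fun i => (t i).2)

theorem exists_isSmallestOccurrence (P : RookPlacement F) {k : ℕ} (h : ¬ P.Avoids k) :
    ∃ s : Fin k → ℕ × ℕ, P.IsSmallestOccurrence s := by
  have h' : {s : Fin k → ℕ × ℕ | P.IsOccurrence s}.Nonempty := not_not.1 h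
  have hfin : {s : Fin k → ℕ × ℕ | P.IsOccurrence s}.Finite :=
    (Set.Finite.pi' (fun _ : Fin k => P.squares.finite_toSet)).subset
      (fun s hs i => hs.mem i)
  obtain ⟨s, hs, hmin⟩ := Set.exists_min_image _
    (fun s : Fin k → ℕ × ℕ => toLex (fun i => (s i).2)) hfin h'
  exact ⟨s, hs, hmin⟩

theorem IsSmallestOccurrence.unique {P : RookPlacement F} {k : ℕ} {s t : Fin k → ℕ × ℕ}
    (hs : P.IsSmallestOccurrence s) (ht : P.IsSmallestOccurrence t) : s = t := by
  have h := toLex.injective (le_antisymm (hs.2 t ht.1) (ht.2 s hs.1))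
  funext i
  exact P.row_unique _ (hs.1.mem i) _ (ht.1.mem i) (congrFun h i)

/-- The markers after the cyclic move along `s`: in the column of `s i` the marker now stands in
the row of `s (i+1)`, and in the column of the last square of `s` it stands in the row of the
first one. All other markers stay. -/
def movedSquares (P : RookPlacement F) {k : ℕ} (s : Fin k → ℕ × ℕ) : Finset (ℕ × ℕ) :=
  (P.squares \ Finset.univ.image s) ∪
    Finset.univ.image (fun i => ((s i).1, (s (finRotate k i)).2))

theorem mem_movedSquares (P : RookPlacement F) {k : ℕ} (s : Fin k → ℕ × ℕ) (x : ℕ × ℕ) :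
    x ∈ P.movedSquares s ↔ (x ∈ P.squares ∧ ∀ i, s i ≠ x) ∨
      ∃ i, ((s i).1, (s (finRotate k i)).2) = x := by
  simp [movedSquares]

/-- The placement obtained from `P` by the cyclic move along an occurrence `s`. -/
def move (P : RookPlacement F) {k : ℕ} (s : Fin k → ℕ × ℕ) (hs : P.IsOccurrence s) :
    RookPlacement F where
  squares := P.movedSquares s
  subset := by
    intro x hx
    rcases (P.mem_movedSquares s x).1 hx with ⟨h, -⟩ | ⟨i, rfl⟩
    · exact P.subset h
    · obtain ⟨p, q, hF, hpq⟩ := hs.rect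
      have h1 := hpq i
      have h2 := hpq (finRotate k i)
      exact (YoungDiagram.mem_cells _).2
        (hF _ ⟨⟨h1.1.1, h2.1.2⟩, ⟨h1.2.1, h2.2.2⟩⟩)
  col_unique := by
    intro x hx y hy h
    rcases (P.mem_movedSquares s x).1 hx with ⟨hx, hx'⟩ | ⟨i, rfl⟩ <;>
    rcases (P.mem_movedSquares s y).1 hy with ⟨hy, hy'⟩ | ⟨j, rfl⟩
    · exact P.col_unique x hx y hy h
    · exact absurd (P.col_unique _ (hs.mem j) x hx h.symm) (hx' j)
    · exact absurd (P.col_unique _ (hs.mem i) y hy h) (hy' i)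
    · have hij : i = j := by
        rcases lt_trichotomy i j with hlt | heq | hlt
        · exact absurd h (hs.col_lt i j hlt).ne
        · exact heq
        · exact absurd h (hs.col_lt j i hlt).ne'
      rw [hij]
  row_unique := by
    intro x hx y hy h
    rcases (P.mem_movedSquares s x).1 hx with ⟨hx, hx'⟩ | ⟨i, rfl⟩ <;>
    rcases (P.mem_movedSquares s y).1 hy with ⟨hy, hy'⟩ | ⟨j, rfl⟩
    · exact P.row_unique x hx y hy h
    · exact absurd (P.row_unique _ (hs.mem _) x hx h.symm) (hx' _)
    · exact absurd (P.row_unique _ (hs.mem _) y hy h) (hy' _)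
    · have hij : finRotate k i = finRotate k j := by
        rcases lt_trichotomy (finRotate k i) (finRotate k j) with hlt | heq | hlt
        · exact absurd h (hs.row_gt _ _ hlt).ne'
        · exact heq
        · exact absurd h (hs.row_gt _ _ hlt).ne
      rw [(finRotate k).injective hij]

open Classical in
/-- The map `φ` (for the pattern `k … 1`): the cyclic move along the smallest occurrence of
`k … 1`, if there is an occurrence; otherwise `P` is left unchanged. -/
noncomputable def phi (k : ℕ) (P : RookPlacement F) : RookPlacement F :=
  if h : P.Avoids k then P
  else P.move (P.exists_isSmallestOccurrence h).choose
    (P.exists_isSmallestOccurrence h).choose_spec.1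

theorem sum_lt_sum_move (P : RookPlacement F) {k : ℕ} (hk : 2 ≤ k) (s : Fin k → ℕ × ℕ)
    (hs : P.IsOccurrence s) :
    ∑ x ∈ P.squares, x.1 * x.2 < ∑ x ∈ (P.move s hs).squares, x.1 * x.2 := by
  have hcol : Function.Injective (fun i => (s i).1) :=
    StrictMono.injective (fun i j h => hs.col_lt i j h)
  have hinj : Function.Injective s := fun i j h => hcol (congrArg Prod.fst h)
  have hinj' : Function.Injective (fun i => ((s i).1, (s (finRotate k i)).2)) :=
    fun i j h => hcol (Prod.ext_iff.1 h).1
  have hsub : Finset.univ.image s ⊆ P.squares := by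
    intro x hx
    obtain ⟨i, -, rfl⟩ := Finset.mem_image.1 hx
    exact hs.mem i
  have hdisj : Disjoint (P.squares \ Finset.univ.image s)
      (Finset.univ.image (fun i => ((s i).1, (s (finRotate k i)).2))) := by
    rw [Finset.disjoint_left]
    intro x hx hx'
    obtain ⟨i, -, rfl⟩ := Finset.mem_image.1 hx'
    obtain ⟨h1, h2⟩ := Finset.mem_sdiff.1 hx
    exact h2 (Finset.mem_image.2
      ⟨i, Finset.mem_univ _, P.col_unique _ (hs.mem i) _ h1 rfl⟩)
  have hanti : Antivary (fun i => (s i).1) (fun i => (s i).2) := by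
    intro i j h
    by_contra hc
    have hc : (s i).1 < (s j).1 := not_le.1 hc
    rcases lt_trichotomy i j with hlt | heq | hlt
    · exact absurd h (hs.row_gt i j hlt).not_gt
    · subst heq
      exact lt_irrefl _ hc
    · exact absurd hc (hs.col_lt j i hlt).not_gt
  have key : ∑ i, (s i).1 * (s i).2 < ∑ i, (s i).1 * (s (finRotate k i)).2 := by
    refine (hanti.sum_mul_lt_sum_mul_comp_perm_iff (σ := finRotate k)).2 ?_
    intro hv
    obtain ⟨n, rfl⟩ : ∃ n, k = n + 2 := ⟨k - 2, by omega⟩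
    have h0 : finRotate (n + 2) (Fin.last (n + 1)) = 0 := finRotate_last
    have h1 : finRotate (n + 2) 0 = 1 := by simp
    have hrow : (s (finRotate (n + 2) 0)).2 < (s (finRotate (n + 2) (Fin.last (n + 1)))).2 := by
      rw [h0, h1]
      exact hs.row_gt 0 1 (by simp)
    have hc := hs.col_lt 0 (Fin.last (n + 1)) (Fin.last_pos)
    exact absurd hc (hv hrow).not_gt
  have e1 := Finset.sum_sdiff (f := fun x : ℕ × ℕ => x.1 * x.2) hsub
  have e2 : ∑ x ∈ (P.move s hs).squares, x.1 * x.2 =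
      ∑ x ∈ P.squares \ Finset.univ.image s, x.1 * x.2 +
        ∑ i, (s i).1 * (s (finRotate k i)).2 := by
    change ∑ x ∈ (P.squares \ Finset.univ.image s) ∪
      Finset.univ.image (fun i => ((s i).1, (s (finRotate k i)).2)), x.1 * x.2 = _
    rw [Finset.sum_union hdisj, Finset.sum_image (fun i _ j _ h => hinj' h)]
  rw [Finset.sum_image (fun i _ j _ h => hinj h)] at e1
  omega

/-- Iterating `φ` removes all occurrences of `k … 1` after finitely many steps. -/
theorem exists_avoids_iterate {k : ℕ} (hk : 2 ≤ k) (P : RookPlacement F) :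
    ∃ m, ((phi k)^[m] P).Avoids k := by
  induction h : ∑ x ∈ F.cells, x.1 * x.2 - ∑ x ∈ P.squares, x.1 * x.2
    using Nat.strong_induction_on generalizing P with
  | _ N ih =>
    by_cases ha : P.Avoids k
    · exact ⟨0, ha⟩
    · have hlt : ∑ x ∈ P.squares, x.1 * x.2 < ∑ x ∈ (phi k P).squares, x.1 * x.2 := by
        rw [phi, dif_neg ha]
        exact P.sum_lt_sum_move hk _ _
      have hle : ∑ x ∈ (phi k P).squares, x.1 * x.2 ≤ ∑ x ∈ F.cells, x.1 * x.2 :=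
        Finset.sum_le_sum_of_subset (phi k P).subset
      obtain ⟨m, hm⟩ := ih _ (by omega) (phi k P) rfl
      exact ⟨m + 1, hm⟩

open Classical in
/-- The map `φ*`: apply `φ` repeatedly until no occurrence of `k … 1` remains. -/
noncomputable def phiStar (k : ℕ) (hk : 2 ≤ k) (P : RookPlacement F) : RookPlacement F :=
  (phi k)^[Nat.find (exists_avoids_iterate hk P)] P

end RookPlacement

/-! Put n = k - 1. Each column carries a vertical line running upwards and each row a horizontal
line running to the right; all start uncoloured (colour 0). Where two lines cross, two uncoloured
lines both become 1 if the square holds a rook, two lines of the same colour v ≠ 0 both become v +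
1, with n wrapping to 1, and otherwise nothing changes. The rule treats the two lines alike, so
reflecting the placement merely exchanges the two families of lines.

The theorem follows from two facts about the colours with which the lines leave the board. First,
they determine a placement that avoids k…1 (`RookPlacement.eq_of_boundaryEq`): in such a placement
the wrap never occurs inside the board, and without the wrap the rule can be run backwards from the
boundary. Second, φ does not change them (`RookPlacement.boundaryEq_move`). Hence φ*(P') and
(φ*(P))' both avoid k…1 and have the same boundary colours as P', so they coincide.

The second fact rests on Schensted insertion. Read the rows from the bottom up and insert the column
of each rook into a tableau. As long as nothing is bumped out of tableau row n, the colour of a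
vertical line is the tableau row that holds its column, and the colour of a horizontal line counts
the insertion steps made so far to its left. The top row r 0 of the smallest occurrence is the first
one in which a column is bumped out of tableau row n, and that column is c n, the last of the
occurrence. The wrap from n to 1 there imitates the rook that the move puts into (c n, r 0). It
remains to compare the tableaux just below row r 0 before and after the move. `Greedy.skel` shows
that the move along a greedy chain induces, on the word of bumped columns, a move along a greedy
chain with one rook fewer; iterating it shows that every tableau row differs in exactly the entry
which inserting c 0 replaces. -/

namespace RookWord

/-! ### Row insertion of a partial word and its bumped word -/

/-- The smallest element of `S` that exceeds `c`. -/
def next (S : Finset ℕ) (c : ℕ) : Option ℕ :=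
  if h : (S.filter (c < ·)).Nonempty then some ((S.filter (c < ·)).min' h) else none

theorem next_eq_some {S : Finset ℕ} {c g : ℕ} :
    next S c = some g ↔ g ∈ S ∧ c < g ∧ ∀ e ∈ S, c < e → g ≤ e := by
  unfold next
  split_ifs with h
  · rw [Option.some.injEq, Finset.min'_eq_iff]
    simp only [Finset.mem_filter]
    tauto
  · simp only [false_iff]
    rintro ⟨h1, h2, -⟩
    exact h ⟨g, Finset.mem_filter.2 ⟨h1, h2⟩⟩

theorem exists_next {S : Finset ℕ} {c e : ℕ} (he : e ∈ S) (hc : c < e) :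
    ∃ g, next S c = some g := by
  unfold next
  rw [dif_pos ⟨e, Finset.mem_filter.2 ⟨he, hc⟩⟩]
  exact ⟨_, rfl⟩

theorem next_congr {S T : Finset ℕ} {c d : ℕ}
    (h : ∀ e, (e ∈ S ∧ c < e) ↔ (e ∈ T ∧ d < e)) : next S c = next T d := by
  have : S.filter (c < ·) = T.filter (d < ·) := by
    ext e; simpa using h e
  unfold next
  simp only [this]

/-- A partial map from rows to columns is read from the bottom row upwards; `act w b` is the set
of columns in the first row of the insertion tableau once the rows below `b` are inserted. -/
def act (w : ℕ → Option ℕ) : ℕ → Finset ℕ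
  | 0 => ∅
  | b + 1 => (w b).elim (act w b)
      fun c => insert c ((act w b).filter fun e => next (act w b) c ≠ some e)

/-- The column that is bumped out of the first row of the insertion tableau at each step. -/
def skel (w : ℕ → Option ℕ) (b : ℕ) : Option ℕ := (w b).bind (next (act w b))

/-- Every column is used at most once. -/
def Inj (w : ℕ → Option ℕ) : Prop := ∀ a b b', w b = some a → w b' = some a → b = b'

variable {w w' : ℕ → Option ℕ}

theorem skel_eq_some {b g : ℕ} :
    skel w b = some g ↔ ∃ c, w b = some c ∧ next (act w b) c = some g := by
  simp [skel, Option.bind_eq_some_iff]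

theorem skel_of_none {b : ℕ} (h : w b = none) : skel w b = none := by simp [skel, h]

theorem skel_of_some {b c : ℕ} (h : w b = some c) : skel w b = next (act w b) c := by
  simp [skel, h]

theorem mem_act_succ {a b : ℕ} :
    a ∈ act w (b + 1) ↔ w b = some a ∨ (a ∈ act w b ∧ skel w b ≠ some a) := by
  rcases h : w b with _ | c
  · simp [act, skel, h]
  · simp only [act, skel, h, Option.elim_some, Option.bind_some, Finset.mem_insert,
      Finset.mem_filter, Option.some.injEq]
    tauto

theorem exists_of_mem_act {a b : ℕ} (h : a ∈ act w b) : ∃ b' < b, w b' = some a := by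
  induction b with
  | zero => simp [act] at h
  | succ b ih =>
    rcases mem_act_succ.1 h with h | ⟨h, -⟩
    · exact ⟨b, b.lt_succ_self, h⟩
    · obtain ⟨b', hb, h⟩ := ih h
      exact ⟨b', by omega, h⟩

/-- An active column is active ever since it was inserted. -/
theorem mem_act_of_le (hw : Inj w) {a b p b' : ℕ} (h : a ∈ act w b) (hp : w p = some a)
    (h1 : p < b') (h2 : b' ≤ b) : a ∈ act w b' := by
  induction b, h2 using Nat.le_induction with
  | base => exact h
  | succ b hb ih =>
    rcases mem_act_succ.1 h with h | ⟨h, -⟩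
    · have := hw _ _ _ h hp
      omega
    · exact ih h

theorem not_mem_act (hw : Inj w) {a p b : ℕ} (hp : w p = some a) (hb : b ≤ p) :
    a ∉ act w b := by
  intro h
  obtain ⟨q, hq, h⟩ := exists_of_mem_act h
  have := hw _ _ _ h hp
  omega

theorem mem_act_of_skel {b g : ℕ} (h : skel w b = some g) : g ∈ act w b := by
  obtain ⟨c, -, h⟩ := skel_eq_some.1 h
  exact (next_eq_some.1 h).1

/-- A column enters the first tableau row only once, so after being bumped it cannot be there again
to be bumped a second time. This is what allows `skel` to be iterated. -/
theorem Inj.skel (hw : Inj w) : Inj (skel w) := by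
  have key : ∀ a b b', b < b' → RookWord.skel w b = some a → RookWord.skel w b' = some a →
      False := by
    intro a b b' hlt h h'
    obtain ⟨p, hp, hwp⟩ := exists_of_mem_act (mem_act_of_skel h)
    have := mem_act_of_le hw (mem_act_of_skel h') hwp (b' := b + 1) (by omega) hlt
    rcases mem_act_succ.1 this with h1 | ⟨-, h1⟩
    · have := hw _ _ _ h1 hwp
      omega
    · exact h1 h
  intro a b b' h h'
  rcases lt_trichotomy b b' with hlt | rfl | hlt
  · exact (key a b b' hlt h h').elim
  · rfl
  · exact (key a b' b hlt h' h).elim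

/-- `Chain w m c b`: a chain of `m + 1` rooks going down to the right starts at `(c, b)`. -/
def Chain (w : ℕ → Option ℕ) : ℕ → ℕ → ℕ → Prop
  | 0, c, b => w b = some c
  | m + 1, c, b => w b = some c ∧ ∃ c' b', c < c' ∧ b' < b ∧ Chain w m c' b'

theorem Chain.eq_some {m c b : ℕ} (h : Chain w m c b) : w b = some c := by
  cases m with
  | zero => exact h
  | succ m => exact h.1

/-- A chain of bumped columns comes from a longer chain. -/
theorem Chain.of_skel (hw : Inj w) {m g b : ℕ} (h : Chain (skel w) m g b) :
    ∃ c, w b = some c ∧ c < g ∧ ∃ g' b', g ≤ g' ∧ b' < b ∧ Chain w m g' b' := by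
  induction m generalizing g b with
  | zero =>
    obtain ⟨c, hc, hn⟩ := skel_eq_some.1 h.eq_some
    obtain ⟨hg, hcg, -⟩ := next_eq_some.1 hn
    obtain ⟨p, hp, hwp⟩ := exists_of_mem_act hg
    exact ⟨c, hc, hcg, g, p, le_rfl, hp, hwp⟩
  | succ m ih =>
    obtain ⟨h0, g₁, b₁, hg, hb, h1⟩ := h
    obtain ⟨c, hc, hn⟩ := skel_eq_some.1 h0
    obtain ⟨hga, hcg, -⟩ := next_eq_some.1 hn
    refine ⟨c, hc, hcg, ?_⟩
    obtain ⟨c₁, hc₁, hcg₁, g', b', hg', hb', hch⟩ := ih h1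
    obtain ⟨p, hp, hwp⟩ := exists_of_mem_act hga
    -- If `c₁ < g`, then `g` was inserted above row `b₁`: had it been active in row `b₁`, it would
    -- have been bumped there before the larger `g₁`. So the rook of `g` can replace that of `c₁`.
    rcases le_or_gt g c₁ with hle | hlt
    · exact ⟨c₁, b₁, hle, hb, hc₁, g', b', by omega, hb', hch⟩
    · rcases lt_trichotomy p b₁ with hpb | rfl | hpb
      · exfalso
        have hS : g ∈ act w b₁ := mem_act_of_le hw hga hwp hpb hb.le
        obtain ⟨d, hd, hn⟩ := skel_eq_some.1 h1.eq_some
        rw [hc₁] at hd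
        cases hd
        have := (next_eq_some.1 hn).2.2 g hS hlt
        omega
      · rw [hc₁] at hwp; cases hwp; omega
      · exact ⟨g, p, le_rfl, hp, hwp, g', b', by omega, by omega, hch⟩

end RookWord

/-! ### Greedy chains, and the first tableau row before and after the move -/

namespace RookWord

variable {w w' : ℕ → Option ℕ}

/-- The rooks `(c 0, r 0), …, (c m, r m)` form a chain going down to the right which is chosen
greedily: `r 0` is the lowest row from which a chain of this length starts, and each later rook is
as low as possible among those that continue to a chain of the required length. -/
structure Greedy (w : ℕ → Option ℕ) (m : ℕ) (c r : ℕ → ℕ) : Prop where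
  inj : Inj w
  eq_some : ∀ i ≤ m, w (r i) = some (c i)
  col_lt : ∀ i < m, c i < c (i + 1)
  row_lt : ∀ i < m, r (i + 1) < r i
  top : ∀ a b, Chain w m a b → r 0 ≤ b
  low : ∀ i l a b, i + 1 + l = m → Chain w l a b → c i < a → r (i + 1) ≤ b

/-- Below row `r 0`, the word `w'` is `w` with each `c (i + 1)` replaced by `c i`. -/
structure Shift (w w' : ℕ → Option ℕ) (m : ℕ) (c r : ℕ → ℕ) : Prop where
  shifted : ∀ i < m, w' (r (i + 1)) = some (c i)
  fixed : ∀ b < r 0, (∀ i < m, b ≠ r (i + 1)) → w' b = w b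

theorem Greedy.chain {m : ℕ} {c r : ℕ → ℕ} (h : Greedy w m c r) (l i : ℕ) (hi : i + l = m) :
    Chain w l (c i) (r i) := by
  induction l generalizing i with
  | zero => exact h.eq_some i (by omega)
  | succ l ih =>
    exact ⟨h.eq_some i (by omega), c (i + 1), r (i + 1), h.col_lt i (by omega),
      h.row_lt i (by omega), ih (i + 1) (by omega)⟩

theorem Greedy.row_anti {m : ℕ} {c r : ℕ → ℕ} (h : Greedy w m c r) {i j : ℕ} (hij : i < j)
    (hj : j ≤ m) : r j < r i := by
  induction j, hij using Nat.le_induction with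
  | base => exact h.row_lt i (by omega)
  | succ j hij ih => exact (h.row_lt j (by omega)).trans (ih (by omega))

/-- A rook in this strip to the left of `c (i + 1)` can be continued by the rest of the chain, so it
would have been preferred to the rook in row `r i` unless it lies to the left of the preceding rook
of the chain. -/
theorem Greedy.empty {m : ℕ} {c r : ℕ → ℕ} (h : Greedy w (m + 1) c r) {i b d : ℕ} (hi : i ≤ m)
    (h1 : r (i + 1) < b) (h2 : b < r i) (hd : w b = some d) :
    c (i + 1) < d ∨ ∃ j, i = j + 1 ∧ d < c j := by
  rcases lt_trichotomy (c (i + 1)) d with hlt | rfl | hlt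
  · exact Or.inl hlt
  · have := h.inj _ _ _ hd (h.eq_some (i + 1) (by omega))
    omega
  · right
    have hc : Chain w (m - i + 1) d b :=
      ⟨hd, _, _, hlt, h1, h.chain (m - i) (i + 1) (by omega)⟩
    rcases i with _ | j
    · have := h.top d b hc
      omega
    · refine ⟨j, rfl, ?_⟩
      by_contra hcon
      rcases (not_lt.1 hcon).lt_or_eq with hlt' | rfl
      · have := h.low j _ d b (by omega) hc hlt'
        omega
      · have := h.inj _ _ _ hd (h.eq_some j (by omega))
        have := h.row_lt j (by omega)
        omega

theorem Greedy.empty_bot {m : ℕ} {c r : ℕ → ℕ} (h : Greedy w (m + 1) c r) {b d : ℕ}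
    (hb : b < r (m + 1)) (hd : w b = some d) : d < c m := by
  by_contra hcon
  rcases (not_lt.1 hcon).lt_or_eq with hlt | rfl
  · have := h.low m 0 d b (by omega) hd hlt
    omega
  · have := h.inj _ _ _ hd (h.eq_some m (by omega))
    have := h.row_lt m (by omega)
    omega

/-- The active columns of `w'` arise from those of `w` by replacing `f`, the first one after `c`,
by `c`. -/
structure StageA (w w' : ℕ → Option ℕ) (c b f : ℕ) : Prop where
  mem : f ∈ act w b
  lt : c < f
  min : ∀ e ∈ act w b, c < e → f ≤ e
  iff : ∀ a, a ∈ act w' b ↔ a = c ∨ (a ∈ act w b ∧ a ≠ f)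

/-- The active columns of `w` and `w'` agree, and none of them lies between `c₀` and `c`. -/
structure StageB (w w' : ℕ → Option ℕ) (c₀ c b : ℕ) : Prop where
  eq : ∀ a, a ∈ act w' b ↔ a ∈ act w b
  empty : ∀ e ∈ act w b, c₀ < e → c ≤ e

theorem StageA.step_none {c b f : ℕ} (h : StageA w w' c b f) (hw : w b = none)
    (hw' : w' b = none) : StageA w w' c (b + 1) f := by
  have key : ∀ a, a ∈ act w (b + 1) ↔ a ∈ act w b := fun a => by
    rw [mem_act_succ]; simp [hw, skel]
  have key' : ∀ a, a ∈ act w' (b + 1) ↔ a ∈ act w' b := fun a => by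
    rw [mem_act_succ]; simp [hw', skel]
  exact ⟨(key f).2 h.mem, h.lt, fun e he => h.min e ((key e).1 he),
    fun a => by rw [key, key', h.iff]⟩

theorem StageA.step_right {c b f d : ℕ} (h : StageA w w' c b f) (hw : w b = some d)
    (hw' : w' b = some d) (hd : f < d) :
    StageA w w' c (b + 1) f ∧ skel w' b = skel w b ∧ skel w b ≠ some f := by
  have hlt := h.lt
  have hs : skel w' b = skel w b := by
    rw [skel_of_some hw, skel_of_some hw']
    refine next_congr fun e => ?_
    rw [h.iff]
    constructor
    · rintro ⟨rfl | h1, h2⟩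
      · omega
      · exact ⟨h1.1, h2⟩
    · rintro ⟨h1, h2⟩
      exact ⟨Or.inr ⟨h1, by omega⟩, h2⟩
  have hne : ∀ e ≤ f, skel w b ≠ some e := fun e he hcon => by
    rw [skel_of_some hw] at hcon
    have := (next_eq_some.1 hcon).2.1
    omega
  refine ⟨⟨?_, h.lt, ?_, ?_⟩, hs, hne f le_rfl⟩
  · exact mem_act_succ.2 (Or.inr ⟨h.mem, hne f le_rfl⟩)
  · intro e he hce
    rcases mem_act_succ.1 he with he | ⟨he, -⟩
    · rw [hw] at he; cases he; exact hd.le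
    · exact h.min e he hce
  · intro a
    rw [mem_act_succ, mem_act_succ, hs, hw, hw', h.iff]
    have := hne c hlt.le
    have := hne f le_rfl
    constructor
    · rintro (h1 | ⟨h1 | h1, h2⟩)
      · exact Or.inr ⟨Or.inl h1, fun haf => by cases h1; omega⟩
      · exact Or.inl h1
      · exact Or.inr ⟨Or.inr ⟨h1.1, h2⟩, h1.2⟩
    · rintro (rfl | ⟨h1 | h1, h2⟩)
      · exact Or.inr ⟨Or.inl rfl, hne a hlt.le⟩
      · exact Or.inl h1
      · exact Or.inr ⟨Or.inr ⟨h1.1, h2⟩, h1.2⟩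

/-- If the first active column of `w` after `d` is below `c`, both words bump it. Otherwise it is
`f`, while `w'` bumps `c`; the only difference between the two rows is thereby removed. -/
theorem StageA.step_left {c b f d c₀ : ℕ} (h : StageA w w' c b f) (hw : w b = some d)
    (hw' : w' b = some d) (hc : c ∉ act w b) (hd : d < c₀) (hc₀ : c₀ < c) :
    (StageA w w' c (b + 1) f ∧ skel w' b = skel w b ∧ skel w b ≠ some f) ∨
    (StageB w w' c₀ c (b + 1) ∧ skel w b = some f ∧ skel w' b = some c) := by
  have hlt := h.lt
  obtain ⟨g, hg⟩ := exists_next h.mem (show d < f by omega)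
  obtain ⟨g', hg'⟩ := exists_next ((h.iff c).2 (Or.inl rfl)) (show d < c by omega)
  have hs := skel_of_some hw
  have hs' := skel_of_some hw'
  rw [hg] at hs
  rw [hg'] at hs'
  obtain ⟨k1, k2, k3⟩ := next_eq_some.1 hg
  obtain ⟨k1', k2', k3'⟩ := next_eq_some.1 hg'
  have hgc : g ≠ c := fun e => hc (e ▸ k1)
  have hgf : g ≤ f := k3 f h.mem (by omega)
  have hgc' : g' ≤ c := k3' c ((h.iff c).2 (Or.inl rfl)) (by omega)
  rcases lt_or_gt_of_ne hgc with hlt' | hlt'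
  · left
    have hgg : g' = g := by
      have := k3' g ((h.iff g).2 (Or.inr ⟨k1, by omega⟩)) k2
      rcases (h.iff g').1 k1' with h1 | h1
      · omega
      · have := k3 g' h1.1 k2'
        omega
    subst hgg
    refine ⟨⟨?_, h.lt, ?_, ?_⟩, by rw [hs, hs'], by rw [hs, Ne, Option.some.injEq]; omega⟩
    · exact mem_act_succ.2 (Or.inr ⟨h.mem, by rw [hs, Ne, Option.some.injEq]; omega⟩)
    · intro e he hce
      rcases mem_act_succ.1 he with he | ⟨he, -⟩
      · rw [hw] at he; cases he; omega
      · exact h.min e he hce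
    · intro a
      rw [mem_act_succ, mem_act_succ, hs, hs', hw, hw', h.iff]
      simp only [Option.some.injEq, ne_eq]
      grind
  · right
    have hgf' : g = f := le_antisymm hgf (h.min g k1 hlt')
    subst hgf'
    have hgc'' : g' = c := by
      rcases (h.iff g').1 k1' with h1 | h1
      · exact h1
      · have := k3 g' h1.1 k2'
        omega
    subst hgc''
    refine ⟨⟨?_, ?_⟩, hs, hs'⟩
    · intro a
      rw [mem_act_succ, mem_act_succ, hs, hs', hw, hw', h.iff]
      simp only [Option.some.injEq, ne_eq]
      grind
    · intro e he hce
      rcases mem_act_succ.1 he with he | ⟨he, -⟩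
      · rw [hw] at he; cases he; omega
      · have := k3 e he (by omega)
        omega

/-- Inserting `c` into the row of `w` bumps `f` and so produces the row that `w'` had already. The
new difference is then due to `w'` alone, which inserts `c₀` and bumps `f'`. -/
theorem StageA.step_top {c b f c₀ : ℕ} (h : StageA w w' c b f) (hw : w b = some c)
    (hw' : w' b = some c₀) (hc₀ : c₀ < c) :
    skel w b = some f ∧
    ∃ f', skel w' b = some f' ∧ f' ≤ c ∧ StageA w w' c₀ (b + 1) f' := by
  have hs : skel w b = some f := by
    rw [skel_of_some hw, next_eq_some]
    exact ⟨h.mem, h.lt, h.min⟩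
  obtain ⟨g, hg⟩ := exists_next ((h.iff c).2 (Or.inl rfl)) hc₀
  have hs' := skel_of_some hw'
  rw [hg] at hs'
  obtain ⟨k1, k2, k3⟩ := next_eq_some.1 hg
  have key : ∀ a, a ∈ act w (b + 1) ↔ a ∈ act w' b := by
    intro a
    rw [mem_act_succ, hs, hw, h.iff]
    simp only [Option.some.injEq, ne_eq]
    grind
  refine ⟨hs, g, hs', k3 c ((h.iff c).2 (Or.inl rfl)) hc₀, (key g).2 k1, k2, ?_, ?_⟩
  · intro e he
    exact k3 e ((key e).1 he)
  · intro a
    rw [key, mem_act_succ, hs', hw']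
    simp only [Option.some.injEq, ne_eq]
    grind

theorem StageB.step_none {c₀ c b : ℕ} (h : StageB w w' c₀ c b) (hw : w b = none)
    (hw' : w' b = none) : StageB w w' c₀ c (b + 1) := by
  have key : ∀ a, a ∈ act w (b + 1) ↔ a ∈ act w b := fun a => by
    rw [mem_act_succ]; simp [hw, skel]
  have key' : ∀ a, a ∈ act w' (b + 1) ↔ a ∈ act w' b := fun a => by
    rw [mem_act_succ]; simp [hw', skel]
  exact ⟨fun a => by rw [key, key', h.eq], fun e he => h.empty e ((key e).1 he)⟩

theorem StageB.step_some {c₀ c b d : ℕ} (h : StageB w w' c₀ c b) (hw : w b = some d)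
    (hw' : w' b = some d) (hd : d < c₀ ∨ c < d) :
    StageB w w' c₀ c (b + 1) ∧ skel w' b = skel w b := by
  have hs : skel w' b = skel w b := by
    rw [skel_of_some hw, skel_of_some hw']
    exact next_congr fun e => by rw [h.eq]
  refine ⟨⟨fun a => by rw [mem_act_succ, mem_act_succ, hs, hw, hw', h.eq], ?_⟩, hs⟩
  intro e he hce
  rcases mem_act_succ.1 he with he | ⟨he, -⟩
  · rw [hw] at he; cases he; omega
  · exact h.empty e he hce

/-- Nothing active lies between `c₀` and `c`, so inserting either one bumps the same column, if any;
the rows then differ by `c` against `c₀`. -/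
theorem StageB.step_top {c₀ c b : ℕ} (h : StageB w w' c₀ c b) (hw : w b = some c)
    (hw' : w' b = some c₀) (hc : c ∉ act w b) (hc₀ : c₀ < c) :
    skel w' b = skel w b ∧ StageA w w' c₀ (b + 1) c := by
  have hs : skel w' b = skel w b := by
    rw [skel_of_some hw, skel_of_some hw']
    refine next_congr fun e => ?_
    rw [h.eq]
    constructor
    · rintro ⟨h1, h2⟩
      refine ⟨h1, lt_of_le_of_ne (h.empty e h1 h2) ?_⟩
      rintro rfl
      exact hc h1
    · rintro ⟨h1, h2⟩
      exact ⟨h1, by omega⟩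
  refine ⟨hs, mem_act_succ.2 (Or.inl hw), hc₀, ?_, ?_⟩
  · intro e he hce
    rcases mem_act_succ.1 he with he | ⟨he, -⟩
    · rw [hw] at he; cases he; exact le_rfl
    · exact h.empty e he hce
  · intro a
    rw [mem_act_succ, mem_act_succ, hs, hw, hw', h.eq]
    simp only [Option.some.injEq, ne_eq]
    grind

end RookWord

/-! ### The move descends to the bumped word -/

namespace RookWord

variable {w w' : ℕ → Option ℕ}

theorem act_congr {b : ℕ} (h : ∀ b' < b, w' b' = w b') : act w' b = act w b := by
  induction b with
  | zero => rfl
  | succ b ih =>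
    rw [act, act, ih fun b' hb' => h b' (by omega), h b (by omega)]

theorem skel_congr {b : ℕ} (h : ∀ b' ≤ b, w' b' = w b') : skel w' b = skel w b := by
  rw [skel, skel, act_congr fun b' hb' => h b' hb'.le, h b le_rfl]

theorem StageA.unique {c b f f' : ℕ} (h : StageA w w' c b f) (h' : StageA w w' c b f') :
    f = f' :=
  le_antisymm (h.min _ h'.mem h'.lt) (h'.min _ h.mem h.lt)

/-- The rook `(f, ρ)` of `skel w` that belongs to the part of a greedy chain of `w` between the
rows `r (i + 1)` and `r i`. -/
structure Segment (w w' : ℕ → Option ℕ) (c r : ℕ → ℕ) (i f ρ : ℕ) : Prop where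
  le : f ≤ c (i + 1)
  row_lt : r (i + 1) < ρ
  row_le : ρ ≤ r i
  stage : ∀ b, r (i + 1) < b → b ≤ ρ → StageA w w' (c i) b f
  eq_some : skel w ρ = some f
  other : ∀ b, r (i + 1) < b → b < r i → b ≠ ρ → skel w' b = skel w b
  zero : i = 0 → ρ = r 0
  succ : ∀ j, i = j + 1 → ∃ f', skel w' ρ = some f' ∧ f' ≤ c i ∧
    StageA w w' (c j) (r i + 1) f' ∧ (ρ ≠ r i → skel w' (r i) = skel w (r i))

variable {m : ℕ} {c r : ℕ → ℕ}

theorem Shift.row (hG : Greedy w m c r) (hS : Shift w w' m c r) {i b : ℕ} (hi : i < m)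
    (h1 : r (i + 1) < b) (h2 : b < r i) : w' b = w b := by
  have hle : r i ≤ r 0 := by
    rcases i with _ | i
    · exact le_rfl
    · exact (hG.row_anti (Nat.succ_pos i) hi.le).le
  refine hS.fixed b (by omega) fun j hj hbj => ?_
  subst hbj
  rcases lt_trichotomy i j with h | rfl | h
  · have := hG.row_anti (show i + 1 < j + 1 by omega) (by omega)
    omega
  · omega
  · rcases (show j + 1 ≤ i by omega).lt_or_eq with h' | rfl
    · have := hG.row_anti h' hi.le
      omega
    · omega

theorem Shift.row_bot (hG : Greedy w (m + 1) c r) (hS : Shift w w' (m + 1) c r) {b : ℕ}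
    (hb : b < r (m + 1)) : w' b = w b := by
  refine hS.fixed b (hb.trans (hG.row_anti (Nat.succ_pos m) le_rfl)) fun j hj hbj => ?_
  subst hbj
  rcases (show j + 1 ≤ m + 1 by omega).lt_or_eq with h' | h'
  · have := hG.row_anti h' le_rfl
    omega
  · rw [h'] at hb
    omega

/-- The strip starts in stage A. Either this lasts up to row `r i`, where inserting `c i` bumps `f`,
so `ρ = r i`; or an earlier row `ρ` bumps `f` from `w` and `c i` from `w'`, and stage B holds from
there up to row `r i`. The second case needs a rook to the left of `c (i - 1)`, hence `i ≠ 0`. -/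
theorem exists_segment (hG : Greedy w (m + 1) c r) (hS : Shift w w' (m + 1) c r) {i f : ℕ}
    (hi : i ≤ m) (hA : StageA w w' (c i) (r (i + 1) + 1) f) (hf : f ≤ c (i + 1)) :
    ∃ ρ, Segment w w' c r i f ρ := by
  have hr := hG.row_lt i (by omega)
  have hna : ∀ b ≤ r i, c i ∉ act w b := fun b hb =>
    not_mem_act hG.inj (hG.eq_some i (by omega)) hb
  have claim : ∀ b, r (i + 1) + 1 ≤ b → b ≤ r i →
      ((∀ b', r (i + 1) < b' → b' ≤ b → StageA w w' (c i) b' f) ∧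
        ∀ b', r (i + 1) < b' → b' < b → skel w' b' = skel w b') ∨
      ∃ ρ j, i = j + 1 ∧ r (i + 1) < ρ ∧ ρ < b ∧
        (∀ b', r (i + 1) < b' → b' ≤ ρ → StageA w w' (c i) b' f) ∧
        skel w ρ = some f ∧ skel w' ρ = some (c i) ∧ StageB w w' (c j) (c i) b ∧
        ∀ b', r (i + 1) < b' → b' < b → b' ≠ ρ → skel w' b' = skel w b' := by
    intro b hb
    induction b, hb using Nat.le_induction with
    | base =>
      intro _
      refine Or.inl ⟨fun b' h1 h2 => ?_, fun b' h1 h2 => by omega⟩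
      obtain rfl : b' = r (i + 1) + 1 := by omega
      exact hA
    | succ b hb ih =>
      intro hbr
      have hw' := hS.row hG (show i < m + 1 by omega) (show r (i + 1) < b by omega) hbr
      rcases ih (by omega) with ⟨ha, hs⟩ | ⟨ρ, j, hj, h1, h2, h3, h4, h5, h6, h7⟩
      · have hab := ha b (by omega) le_rfl
        have left : StageA w w' (c i) (b + 1) f → skel w' b = skel w b →
            (∀ b', r (i + 1) < b' → b' ≤ b + 1 → StageA w w' (c i) b' f) ∧
            ∀ b', r (i + 1) < b' → b' < b + 1 → skel w' b' = skel w b' := by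
          intro h1 h2
          refine ⟨fun b' k1 k2 => ?_, fun b' k1 k2 => ?_⟩
          · rcases k2.lt_or_eq with k | rfl
            · exact ha b' k1 (by omega)
            · exact h1
          · rcases (Nat.lt_succ_iff.1 k2).lt_or_eq with k | rfl
            · exact hs b' k1 k
            · exact h2
        rcases hw : w b with _ | d
        · rw [hw] at hw'
          exact Or.inl (left (hab.step_none hw hw')
            (by rw [skel_of_none hw, skel_of_none hw']))
        · rw [hw] at hw'
          rcases hG.empty hi (by omega) hbr hw with hd | ⟨j, rfl, hd⟩
          · obtain ⟨k1, k2, -⟩ := hab.step_right hw hw' (by omega)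
            exact Or.inl (left k1 k2)
          · rcases hab.step_left hw hw' (hna b (by omega)) hd (hG.col_lt j (by omega)) with
              ⟨k1, k2, -⟩ | ⟨k1, k2, k3⟩
            · exact Or.inl (left k1 k2)
            · refine Or.inr ⟨b, j, rfl, by omega, by omega, ha, k2, k3, k1, ?_⟩
              intro b' h1 h2 h3
              exact hs b' h1 (by omega)
      · right
        have hB : StageB w w' (c j) (c i) (b + 1) ∧ skel w' b = skel w b := by
          rcases hw : w b with _ | d
          · rw [hw] at hw'
            exact ⟨h6.step_none hw hw', by rw [skel_of_none hw, skel_of_none hw']⟩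
          · rw [hw] at hw'
            refine h6.step_some hw hw' ?_
            rcases hG.empty hi (by omega) hbr hw with hd | ⟨j', hj', hd⟩
            · have := hG.col_lt i (by omega)
              omega
            · obtain rfl : j = j' := by omega
              exact Or.inl hd
        refine ⟨ρ, j, hj, h1, by omega, h3, h4, h5, hB.1, fun b' k1 k2 k3 => ?_⟩
        rcases (Nat.lt_succ_iff.1 k2).lt_or_eq with k | rfl
        · exact h7 b' k1 k k3
        · exact hB.2
  have hwi := hG.eq_some i (by omega)
  rcases claim (r i) hr le_rfl with ⟨ha, hs⟩ | ⟨ρ, j, rfl, h1, h2, h3, h4, h5, h6, h7⟩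
  · have hab := ha (r i) hr le_rfl
    refine ⟨r i, hf, hr, le_rfl, ha, ?_, fun b h1 h2 _ => hs b h1 h2, fun h => by rw [h], ?_⟩
    · rw [skel_of_some hwi, next_eq_some]
      exact ⟨hab.mem, hab.lt, hab.min⟩
    · rintro j rfl
      obtain ⟨-, f', k1, k2, k3⟩ :=
        hab.step_top hwi (hS.shifted j (by omega)) (hG.col_lt j (by omega))
      exact ⟨f', k1, k2, k3, fun h => absurd rfl h⟩
  · refine ⟨ρ, hf, h1, h2.le, h3, h4, h7, fun h => by omega, ?_⟩
    intro j' hj'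
    obtain rfl : j = j' := by omega
    obtain ⟨k1, k2⟩ := h6.step_top hwi (hS.shifted j (by omega)) (hna _ le_rfl)
      (hG.col_lt j (by omega))
    exact ⟨c (j + 1), h5, le_rfl, k2, fun _ => k1⟩

/-- Below the last rook of the chain the words agree and use only columns left of `c m`, so stage B
holds trivially when row `r (m + 1)` is reached. -/
theorem stageA_bot (hG : Greedy w (m + 1) c r) (hS : Shift w w' (m + 1) c r) :
    skel w' (r (m + 1)) = skel w (r (m + 1)) ∧
      StageA w w' (c m) (r (m + 1) + 1) (c (m + 1)) := by
  have hB : StageB w w' (c m) (c (m + 1)) (r (m + 1)) := by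
    refine ⟨fun a => ?_, fun e he hlt => ?_⟩
    · rw [act_congr fun b hb => hS.row_bot hG hb]
    · obtain ⟨b, hb, h⟩ := exists_of_mem_act he
      have := hG.empty_bot hb h
      omega
  exact hB.step_top (hG.eq_some _ le_rfl) (hS.shifted m (by omega))
    (not_mem_act hG.inj (hG.eq_some _ le_rfl) le_rfl) (hG.col_lt m (by omega))

theorem exists_segments (hG : Greedy w (m + 1) c r) (hS : Shift w w' (m + 1) c r) :
    ∃ F ρ : ℕ → ℕ, ∀ i ≤ m, Segment w w' c r i (F i) (ρ i) := by
  -- The strips are treated from the bottom upwards: the column `f'` with which strip `i + 1` ends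
  -- is the `f` with which strip `i` begins.
  have key : ∀ l i, i + l = m →
      ∃ f, StageA w w' (c i) (r (i + 1) + 1) f ∧ f ≤ c (i + 1) := by
    intro l
    induction l with
    | zero =>
      rintro i rfl
      exact ⟨_, (stageA_bot hG hS).2, le_rfl⟩
    | succ l ih =>
      intro i hi
      obtain ⟨f, h1, h2⟩ := ih (i + 1) (by omega)
      obtain ⟨ρ, hρ⟩ := exists_segment hG hS (by omega) h1 h2
      obtain ⟨f', -, h3, h4, -⟩ := hρ.succ i rfl
      exact ⟨f', h4, h3⟩
  have : ∀ i, ∃ f ρ, i ≤ m → Segment w w' c r i f ρ := by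
    intro i
    by_cases hi : i ≤ m
    · obtain ⟨f, h1, h2⟩ := key (m - i) i (by omega)
      obtain ⟨ρ, hρ⟩ := exists_segment hG hS hi h1 h2
      exact ⟨f, ρ, fun _ => hρ⟩
    · exact ⟨0, 0, fun h => absurd h hi⟩
  choose F ρ h using this
  exact ⟨F, ρ, h⟩

/-- The effect of the cyclic move along a greedy chain on the first row of the insertion tableau:
the bumped columns undergo the same kind of move. -/
theorem Greedy.skel (hG : Greedy w (m + 1) c r) (hS : Shift w w' (m + 1) c r) :
    ∃ F ρ : ℕ → ℕ, Greedy (skel w) m F ρ ∧ Shift (skel w) (RookWord.skel w') m F ρ ∧ ρ 0 = r 0 ∧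
      F m = c (m + 1) ∧ ∀ a, a ∈ act w' (r 0) ↔ a = c 0 ∨ (a ∈ act w (r 0) ∧ a ≠ F 0) := by
  obtain ⟨F, ρ, h⟩ := exists_segments hG hS
  have h0 : ρ 0 = r 0 := (h 0 (by omega)).zero rfl
  have hlt : ∀ i ≤ m, c i < F i := fun i hi =>
    ((h i hi).stage _ (h i hi).row_lt le_rfl).lt
  have hst : ∀ i ≤ m, StageA w w' (c i) (r (i + 1) + 1) (F i) := fun i hi =>
    (h i hi).stage _ (Nat.lt_succ_self _) (h i hi).row_lt
  have hlink : ∀ i < m, RookWord.skel w' (ρ (i + 1)) = some (F i) ∧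
      (ρ (i + 1) ≠ r (i + 1) →
        RookWord.skel w' (r (i + 1)) = RookWord.skel w (r (i + 1))) := by
    intro i hi
    obtain ⟨f', h1, -, h3, h4⟩ := (h (i + 1) hi).succ i rfl
    obtain rfl := h3.unique (hst i hi.le)
    exact ⟨h1, h4⟩
  refine ⟨F, ρ, ⟨hG.inj.skel, fun i hi => (h i hi).eq_some, fun i hi => ?_, fun i hi => ?_, ?_, ?_⟩,
    ⟨fun i hi => (hlink i hi).1, ?_⟩, h0, ?_, ?_⟩
  · exact ((h i hi.le).le).trans_lt (hlt (i + 1) hi)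
  · exact ((h (i + 1) hi).row_le).trans_lt (h i hi.le).row_lt
  · intro a b hab
    obtain ⟨d, hd, hda, g, b', hg, hb, hch⟩ := hab.of_skel hG.inj
    rw [h0]
    exact hG.top d b ⟨hd, g, b', by omega, hb, hch⟩
  · intro i l g b hil hch hFg
    obtain ⟨d, hd, hdg, g', b', hg, hb, hch'⟩ := hch.of_skel hG.inj
    have hsk := hch.eq_some
    obtain ⟨d', hd', hn⟩ := skel_eq_some.1 hsk
    obtain rfl : d = d' := Option.some.inj (hd.symm.trans hd')
    obtain ⟨hga, -, hmin⟩ := next_eq_some.1 hn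
    by_contra hcon
    have hseg := h (i + 1) (by omega)
    have hrle := hseg.row_le
    have hcF := hlt i (by omega)
    -- Otherwise `d` would start a chain of `w` lower than row `r (i + 1)` that could have followed
    -- the rook of `c i`.
    have hdc : d < c i := by
      by_contra hdc
      rcases (not_lt.1 hdc).lt_or_eq with hlt' | rfl
      · have := hG.low i (l + 1) d b (by omega) ⟨hd, g', b', by omega, hb, hch'⟩ hlt'
        omega
      · have := hG.inj _ _ _ hd (hG.eq_some i (by omega))
        have := hG.row_lt i (by omega)
        omega
    have hcc := hG.col_lt i (by omega)
    -- For large `g`, row `b` lies in the strip where `F (i + 1)` is the first active column after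
    -- `c (i + 1)`; so `g = F (i + 1)`, bumped both in row `b` and in row `ρ (i + 1)`. For small
    -- `g`, the column `F i` lies between `d` and `g`: active in row `b` it would be bumped instead
    -- of `g`, and inserted later it would contradict the greedy choice of `r (i + 1)`.
    rcases lt_or_ge (c (i + 1)) g with hgc | hgc
    · have h1 := hG.low (i + 1) l g' b' (by omega) hch' (by omega)
      have hst' := hseg.stage b (by omega) (by omega)
      have h2 := hmin _ hst'.mem (by have := hst'.lt; omega)
      have h3 := hst'.min g hga hgc
      obtain rfl : g = F (i + 1) := by omega
      have := hG.inj.skel _ _ _ hsk hseg.eq_some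
      omega
    · have hact := (hst i (by omega)).mem
      obtain ⟨p, hp, hwp⟩ := exists_of_mem_act hact
      have hpne : p ≠ r (i + 1) := by
        rintro rfl
        have := hwp.symm.trans (hG.eq_some (i + 1) (by omega))
        rw [Option.some.injEq] at this
        omega
      rcases lt_trichotomy p b with hpb | rfl | hpb
      · have := hmin _ (mem_act_of_le hG.inj hact hwp hpb (by omega)) (by omega)
        omega
      · rw [hd] at hwp; cases hwp; omega
      · have := hG.low i (l + 1) _ p (by omega) ⟨hwp, g', b', by omega, by omega, hch'⟩ hcF
        omega
  · intro b hb hne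
    rw [h0] at hb
    rcases lt_trichotomy b (r (m + 1)) with hb' | rfl | hb'
    · exact skel_congr fun b' hb'' => hS.row_bot hG (by omega)
    · exact (stageA_bot hG hS).1
    · have : ∀ j, j ≤ m → r (j + 1) < b → RookWord.skel w' b = RookWord.skel w b := by
        intro j
        induction j with
        | zero =>
          intro hj hbj
          exact (h 0 hj).other b hbj hb (by omega)
        | succ j ih =>
          intro hj hbj
          rcases lt_trichotomy b (r (j + 1)) with k | rfl | k
          · exact (h (j + 1) hj).other b hbj k (hne j hj)
          · exact (hlink j hj).2 (hne j hj).symm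
          · exact ih (by omega) k
      exact this m le_rfl hb'
  · exact ((stageA_bot hG hS).2.unique (hst m le_rfl)).symm
  · have := (h 0 (by omega)).stage (r 0) (hG.row_lt 0 (by omega)) h0.ge
    exact this.iff

end RookWord

/-! ### All tableau rows, and their description by colours -/

namespace RookWord

variable {w w' : ℕ → Option ℕ}

theorem iterate_skel_succ {j b g : ℕ} (h : skel^[j + 1] w b = some g) :
    ∃ c, skel^[j] w b = some c ∧ c < g ∧ g ∈ act (skel^[j] w) b ∧
      ∀ e ∈ act (skel^[j] w) b, c < e → g ≤ e := by
  rw [Function.iterate_succ_apply'] at h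
  obtain ⟨c, h1, h2⟩ := skel_eq_some.1 h
  obtain ⟨h3, h4, h5⟩ := next_eq_some.1 h2
  exact ⟨c, h1, h4, h3, h5⟩

theorem iterate_skel_lt {i j b x y : ℕ} (hij : i < j) (hx : skel^[i] w b = some x)
    (hy : skel^[j] w b = some y) : x < y := by
  induction j, hij using Nat.le_induction generalizing y with
  | base =>
    obtain ⟨c, h1, h2, -⟩ := iterate_skel_succ hy
    rw [hx] at h1; cases h1; exact h2
  | succ j hij ih =>
    obtain ⟨c, h1, h2, -⟩ := iterate_skel_succ hy
    exact (ih h1).trans h2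

theorem exists_of_iterate_skel {j b a : ℕ} (h : skel^[j] w b = some a) :
    ∃ b' ≤ b, w b' = some a := by
  induction j generalizing b with
  | zero => exact ⟨b, le_rfl, h⟩
  | succ j ih =>
    obtain ⟨-, -, -, h1, -⟩ := iterate_skel_succ h
    obtain ⟨b', hb', h2⟩ := exists_of_mem_act h1
    obtain ⟨b'', hb'', h3⟩ := ih h2
    exact ⟨b'', by omega, h3⟩

theorem exists_of_mem_act_iterate {j b a : ℕ} (h : a ∈ act (skel^[j] w) b) :
    ∃ b' < b, w b' = some a := by
  obtain ⟨b', hb', h2⟩ := exists_of_mem_act h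
  obtain ⟨b'', hb'', h3⟩ := exists_of_iterate_skel h2
  exact ⟨b'', by omega, h3⟩

theorem Shift.isSome {m : ℕ} {c r : ℕ → ℕ} (hG : Greedy w m c r) (hS : Shift w w' m c r)
    {b : ℕ} (hb : b < r 0) : (w' b).isSome = (w b).isSome := by
  by_cases h : ∃ i < m, b = r (i + 1)
  · obtain ⟨i, hi, rfl⟩ := h
    rw [hS.shifted i hi, hG.eq_some (i + 1) hi]
    rfl
  · rw [hS.fixed b hb fun i hi hbi => h ⟨i, hi, hbi⟩]

/-- All rows of the insertion tableau before and after the cyclic move. -/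
theorem Greedy.iterate {n : ℕ} {c r : ℕ → ℕ} (hG : Greedy w n c r) (hS : Shift w w' n c r) :
    ∃ F : ℕ → ℕ, F 0 = c 0 ∧ F n = c n ∧ (∀ j ≤ n, RookWord.skel^[j] w (r 0) = some (F j)) ∧
      (∀ j < n, ∀ a, a ∈ act (RookWord.skel^[j] w') (r 0) ↔
        a = F j ∨ (a ∈ act (RookWord.skel^[j] w) (r 0) ∧ a ≠ F (j + 1))) ∧
      (∀ j ≤ n, ∀ b < r 0, (RookWord.skel^[j] w' b).isSome = (RookWord.skel^[j] w b).isSome) ∧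
      ∀ b < r 0, RookWord.skel^[n] w b = none := by
  induction n generalizing w w' c r with
  | zero =>
    refine ⟨c, rfl, rfl, fun j hj => ?_, fun j hj => by omega, fun j hj b hb => ?_,
      fun b hb => ?_⟩
    · obtain rfl : j = 0 := by omega
      exact hG.eq_some 0 le_rfl
    · obtain rfl : j = 0 := by omega
      exact hS.isSome hG hb
    · by_contra h
      obtain ⟨a, ha⟩ := Option.ne_none_iff_exists'.1 h
      have := hG.top a b ha
      omega
  | succ n ih =>
    obtain ⟨F, ρ, h1, h2, h3, h4, h5⟩ := hG.skel hS
    obtain ⟨F', k0, k1, k2, k3, k4, k5⟩ := ih h1 h2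
    rw [h3] at k2 k3 k4 k5
    -- `F` is the insertion path of row `r 0`: it starts with `c 0` and goes on with the path for
    -- the bumped word, whose greedy chain has the same top row and the same last column.
    refine ⟨fun j => j.casesOn (c 0) F', rfl, k1.trans h4, ?_, ?_, ?_, k5⟩
    · rintro (_ | j) hj
      · exact hG.eq_some 0 (by omega)
      · exact k2 j (by omega)
    · rintro (_ | j) hj a
      · simpa [k0] using h5 a
      · exact k3 j (by omega) a
    · rintro (_ | j) hj b hb
      · exact hS.isSome hG hb
      · exact k4 j (by omega) b hb

/-- The colour with which a line leaves a square that it enters with colour `v`, if the line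
crossing it enters with colour `h`; the colours are `1, …, n`, and `0` stands for an uncoloured
line. The square carries a rook iff `p` holds. -/
def out (n : ℕ) (p : Prop) [Decidable p] (v h : ℕ) : ℕ :=
  if v = h then if v = 0 then if p then 1 else 0 else if v < n then v + 1 else 1 else v

/-- `V a b` is the colour of column `a` when it enters row `b` from below, `H a b` is the colour
of row `b` when it enters column `a` from the left. -/
structure IsColoring (n : ℕ) (S : Finset (ℕ × ℕ)) (V H : ℕ → ℕ → ℕ) : Prop where
  vert_zero : ∀ a, V a 0 = 0
  horiz_zero : ∀ b, H 0 b = 0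
  vert_succ : ∀ a b, V a (b + 1) = out n ((a, b) ∈ S) (V a b) (H a b)
  horiz_succ : ∀ a b, H (a + 1) b = out n ((a, b) ∈ S) (H a b) (V a b)

theorem exists_isColoring (n : ℕ) (S : Finset (ℕ × ℕ)) : ∃ V H, IsColoring n S V H := by
  let row (u : ℕ → ℕ) (b : ℕ) : ℕ → ℕ :=
    Nat.rec 0 fun a h => out n ((a, b) ∈ S) h (u a)
  let V : ℕ → ℕ → ℕ := Nat.rec (fun _ => 0) fun b u a => out n ((a, b) ∈ S) (u a) (row u b a)
  exact ⟨fun a b => V b a, fun a b => row (V b) b a, fun _ => rfl, fun _ => rfl,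
    fun _ _ => rfl, fun _ _ => rfl⟩

/-- The entry `w b` is the column of the rook in row `b`, among the columns to the left of `W`. -/
def IsWord (S : Finset (ℕ × ℕ)) (W : ℕ) (w : ℕ → Option ℕ) : Prop :=
  ∀ a b, w b = some a ↔ (a, b) ∈ S ∧ a < W

variable {n W : ℕ} {S S' : Finset (ℕ × ℕ)} {V H V' H' : ℕ → ℕ → ℕ}

/-- The colour `v` of column `a` below row `b` tells the tableau row that contains `a`. -/
def VertSpec (w : ℕ → Option ℕ) (n a b v : ℕ) : Prop :=
  v ≤ n ∧ ∀ j < n, v = j + 1 ↔ a ∈ act (skel^[j] w) b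

/-- The colour `h` of row `b` before column `a` counts the insertion steps to the left of `a`. -/
def HorizSpec (w : ℕ → Option ℕ) (n a b h : ℕ) : Prop :=
  h ≤ n ∧ ∀ j < n, j + 1 ≤ h ↔ ∃ c, skel^[j] w b = some c ∧ c < a

theorem VertSpec.unique {a b a' b' v v' : ℕ} (h : VertSpec w n a b v)
    (h' : VertSpec w' n a' b' v')
    (heq : ∀ j < n, a ∈ act (skel^[j] w) b ↔ a' ∈ act (skel^[j] w') b') : v = v' := by
  obtain ⟨h1, h2⟩ := h
  obtain ⟨h1', h2'⟩ := h'
  rcases v with _ | v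
  · rcases v' with _ | v'
    · rfl
    · have := (h2 v' (by omega)).2 ((heq v' (by omega)).2 ((h2' v' (by omega)).1 rfl))
      omega
  · have := (h2' v (by omega)).2 ((heq v (by omega)).1 ((h2 v (by omega)).1 rfl))
    omega

/-- For `j ≥ 1`, `v = j` says that `a` sits in tableau row `j`, and `h = j` that the insertion into
this row took place left of `a` but the one into the next row did not. Together they say that `a` is
the column bumped from row `j`. A horizontal colour cannot exceed `n`, so for `j = n` the missing
information is supplied by `hn`. -/
theorem bumped_iff {a b v h : ℕ} (hv : VertSpec w n a b v)
    (hh : HorizSpec w n a b h) (hn : ∀ c, skel^[n] w b = some c → a ≤ c) {j : ℕ} (hj : j ≤ n) :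
    skel^[j] w b = some a ↔ (j = 0 ∧ w b = some a) ∨ (j ≠ 0 ∧ v = j ∧ h = j) := by
  rcases j with _ | j
  · simp
  · simp only [Nat.add_eq_zero_iff, one_ne_zero, and_false, false_and, ne_eq, not_false_eq_true,
      true_and, false_or]
    constructor
    · intro hs
      obtain ⟨c, h1, h2, h3, h4⟩ := iterate_skel_succ hs
      refine ⟨(hv.2 j (by omega)).2 h3, le_antisymm ?_ ((hh.2 j (by omega)).2 ⟨c, h1, h2⟩)⟩
      by_contra hcon
      have := hh.1
      obtain ⟨c', k1, k2⟩ := (hh.2 (j + 1) (by omega)).1 (by omega)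
      rw [hs] at k1; cases k1; omega
    · rintro ⟨rfl, rfl⟩
      have h1 := (hv.2 j (by omega)).1 rfl
      obtain ⟨c, h2, h3⟩ := (hh.2 j (by omega)).1 le_rfl
      obtain ⟨g, hg⟩ := exists_next h1 h3
      have hs : skel^[j + 1] w b = some g := by
        rw [Function.iterate_succ_apply', skel_of_some h2, hg]
      have hga := (next_eq_some.1 hg).2.2 a h1 h3
      have : a ≤ g := by
        rcases hj.lt_or_eq with hj | rfl
        · by_contra hcon
          have := (hh.2 (j + 1) hj).2 ⟨g, hs, by omega⟩
          omega
        · exact hn g hs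
      rw [hs, le_antisymm hga this]

/-- By `bumped_iff`, equal nonzero colours mean that `a` is moved to the next tableau row, which is
the local rule. The strict bound in `hn` excludes the wrap in this square. -/
theorem vertSpec_succ (hinj : Inj w) {a b v h : ℕ} {p : Prop} [Decidable p] (h0 : 1 ≤ n)
    (hp : w b = some a ↔ p) (hv : VertSpec w n a b v)
    (hh : HorizSpec w n a b h) (hn : ∀ c, skel^[n] w b = some c → a < c) :
    VertSpec w n a (b + 1) (out n p v h) ∧ HorizSpec w n (a + 1) b (out n p h v) := by
  have key : ∀ j ≤ n, _ := fun j hj => bumped_iff hv hh (fun c hc => (hn c hc).le) hj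
  have hvn := hv.1
  have hhn := hh.1
  have hrook : p → v = 0 ∧ h = 0 := by
    intro hw
    rw [← hp] at hw
    constructor
    · rcases v with _ | v
      · rfl
      · obtain ⟨b', hb', h1⟩ := exists_of_mem_act_iterate ((hv.2 v (by omega)).1 rfl)
        have := hinj _ _ _ h1 hw
        omega
    · rcases h with _ | h
      · rfl
      · obtain ⟨c, h1, h2⟩ := (hh.2 0 (by omega)).1 (by omega)
        rw [Function.iterate_zero, id, hw] at h1
        cases h1
        omega
  have hnn : ¬ (v = n ∧ h = n) := by
    intro hcon
    have := (key n le_rfl).2 (Or.inr ⟨by omega, hcon⟩)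
    have := hn a this
    omega
  rw [hp] at key
  refine ⟨⟨?_, fun j hj => ?_⟩, ?_, fun j hj => ?_⟩
  · unfold out; split_ifs <;> omega
  · have key' := key (j + 1) hj
    rw [Function.iterate_succ_apply'] at key'
    rw [mem_act_succ, ← hv.2 j hj, key j hj.le]
    simp only [ne_eq, key']
    unfold out
    by_cases hw : p
    · obtain ⟨rfl, rfl⟩ := hrook hw
      simp [hw]; omega
    · simp only [hw, and_false, if_false, false_or]
      split_ifs <;> grind
  · unfold out; split_ifs <;> omega
  · have : (∃ c, skel^[j] w b = some c ∧ c < a + 1) ↔ j + 1 ≤ h ∨ skel^[j] w b = some a := by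
      rw [hh.2 j hj]
      constructor
      · rintro ⟨c, h1, h2⟩
        rcases (Nat.lt_succ_iff.1 h2).lt_or_eq with h2 | rfl
        · exact Or.inl ⟨c, h1, h2⟩
        · exact Or.inr h1
      · rintro (⟨c, h1, h2⟩ | h1)
        · exact ⟨c, h1, by omega⟩
        · exact ⟨a, h1, by omega⟩
    rw [this, key j hj.le]
    unfold out
    by_cases hw : p
    · obtain ⟨rfl, rfl⟩ := hrook hw
      simp [hw]; omega
    · simp only [hw, and_false, if_false, false_or]
      clear this
      split_ifs <;> omega

/-- The bound `a ≤ c` lets the description run through row `r 0` as far as the column where the wrap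
occurs. -/
theorem horizSpec_row (hinj : Inj w) (h0 : 1 ≤ n) (hw : IsWord S W w)
    (hC : IsColoring n S V H) {b : ℕ} (hV : ∀ a < W, VertSpec w n a b (V a b)) {a : ℕ}
    (ha : a ≤ W) (hn : ∀ c, skel^[n] w b = some c → a ≤ c) :
    HorizSpec w n a b (H a b) ∧ ∀ a' < a, VertSpec w n a' (b + 1) (V a' (b + 1)) := by
  induction a with
  | zero =>
    refine ⟨⟨by rw [hC.horiz_zero]; omega, fun j hj => ?_⟩, fun a' ha' => by omega⟩
    rw [hC.horiz_zero]
    simp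
  | succ a ih =>
    obtain ⟨h1, h2⟩ := ih (by omega) fun c hc => (Nat.le_succ a).trans (hn c hc)
    have h3 := vertSpec_succ hinj h0 (p := (a, b) ∈ S) (by rw [hw a b]; exact and_iff_left ha)
      (hV a ha) h1 hn
    rw [← hC.vert_succ, ← hC.horiz_succ] at h3
    refine ⟨h3.2, fun a' ha' => ?_⟩
    rcases (Nat.lt_succ_iff.1 ha').lt_or_eq with h | rfl
    · exact h2 a' h
    · exact h3.1

theorem vertSpec_of_none (hinj : Inj w) (h0 : 1 ≤ n) (hw : IsWord S W w)
    (hC : IsColoring n S V H) {B : ℕ} (hn : ∀ b < B, skel^[n] w b = none) {b : ℕ} (hb : b ≤ B) :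
    ∀ a < W, VertSpec w n a b (V a b) := by
  induction b with
  | zero =>
    intro a _
    rw [hC.vert_zero]
    exact ⟨by omega, fun j hj => by simp [act]⟩
  | succ b ih =>
    exact (horizSpec_row hinj h0 hw hC (ih (by omega)) le_rfl
      (by simp [hn b (by omega)])).2

theorem horizSpec_of_none (hinj : Inj w) (h0 : 1 ≤ n) (hw : IsWord S W w)
    (hC : IsColoring n S V H) {B : ℕ} (hn : ∀ b < B, skel^[n] w b = none) {a b : ℕ} (hb : b < B)
    (ha : a ≤ W) : HorizSpec w n a b (H a b) :=
  (horizSpec_row hinj h0 hw hC (vertSpec_of_none hinj h0 hw hC hn hb.le) ha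
    (by simp [hn b hb])).1

end RookWord

/-! ### Invariance of the colours on a rectangle -/

namespace RookWord

variable {w w' : ℕ → Option ℕ} {n W : ℕ} {S S' : Finset (ℕ × ℕ)} {V H V' H' : ℕ → ℕ → ℕ}

theorem HorizSpec.unique {a b a' b' v v' : ℕ} (h : HorizSpec w n a b v)
    (h' : HorizSpec w' n a' b' v')
    (heq : ∀ j < n, (∃ c, skel^[j] w b = some c ∧ c < a) ↔
      ∃ c, skel^[j] w' b' = some c ∧ c < a') : v = v' := by
  obtain ⟨h1, h2⟩ := h
  obtain ⟨h1', h2'⟩ := h'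
  apply le_antisymm
  · rcases v with _ | v
    · omega
    · exact (h2' v h1).2 ((heq v h1).1 ((h2 v h1).1 le_rfl))
  · rcases v' with _ | v'
    · omega
    · exact (h2 v' h1').2 ((heq v' h1').2 ((h2' v' h1').1 le_rfl))

theorem IsWord.lt_of_iterate_skel (hw : IsWord S W w) {j b c : ℕ}
    (h : skel^[j] w b = some c) : c < W := by
  obtain ⟨b', -, h'⟩ := exists_of_iterate_skel h
  exact ((hw _ _).1 h').2

theorem out_zero {p : Prop} [Decidable p] (hp : ¬ p) (v : ℕ) : out n p v 0 = v := by
  unfold out; split_ifs <;> omega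

theorem zero_out {p : Prop} [Decidable p] (hp : ¬ p) (v : ℕ) : out n p 0 v = 0 := by
  unfold out; split_ifs <;> omega

/-- The cyclic move along a greedy chain does not change the colours on the boundary of the
rectangle spanned by the chain. -/
theorem Greedy.coloring_eq {c r : ℕ → ℕ} (h0 : 1 ≤ n) (hG : Greedy w n c r)
    (hS : Shift w w' n c r) (hinj' : Inj w') (hw : IsWord S W w) (hw' : IsWord S' W w')
    (htop : w' (r 0) = some (c n)) (hC : IsColoring n S V H) (hC' : IsColoring n S' V' H') :
    (∀ b ≤ r 0, H W b = H' W b) ∧ ∀ a < W, V a (r 0 + 1) = V' a (r 0 + 1) := by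
  obtain ⟨F, -, hFn, hF, hact, hsome, hnone⟩ := hG.iterate hS
  have hnone' : ∀ b < r 0, RookWord.skel^[n] w' b = none := fun b hb => by
    have := hsome n le_rfl b hb
    rw [hnone b hb] at this
    simpa using this
  have hV := vertSpec_of_none hG.inj h0 hw hC hnone le_rfl
  have hV' := vertSpec_of_none hinj' h0 hw' hC' hnone' le_rfl
  have hFW : F n < W := hw.lt_of_iterate_skel (hF n le_rfl)
  have hFlt : ∀ j < n, F j < F n := fun j hj =>
    iterate_skel_lt hj (hF j hj.le) (hF n le_rfl)
  have hlow : ∀ b < r 0, H W b = H' W b := by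
    intro b hb
    refine (horizSpec_of_none hG.inj h0 hw hC hnone hb le_rfl).unique
      (horizSpec_of_none hinj' h0 hw' hC' hnone' hb le_rfl) fun j hj => ?_
    have h1 : ∀ u : ℕ → Option ℕ, ∀ T, IsWord T W u →
        ((∃ c, RookWord.skel^[j] u b = some c ∧ c < W) ↔ (RookWord.skel^[j] u b).isSome) := by
      intro u T hu
      rw [Option.isSome_iff_exists]
      exact ⟨fun ⟨c, h, _⟩ => ⟨c, h⟩, fun ⟨c, h⟩ => ⟨c, h, hu.lt_of_iterate_skel h⟩⟩
    rw [h1 w S hw, h1 w' S' hw', hsome j hj.le b hb]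
  obtain ⟨hHF, hVF⟩ := horizSpec_row hG.inj h0 hw hC hV hFW.le fun c' hc' => by
    rw [hF n le_rfl] at hc'; cases hc'; exact le_rfl
  -- In row `r 0` the column `F n = c n` is bumped out of tableau row `n`, so both lines arrive with
  -- colour `n` and wrap to 1. After the move the same square holds a rook, met by two uncoloured
  -- lines, which also become 1.
  have hHn : H (F n) (r 0) = n := by
    refine le_antisymm hHF.1 ?_
    have := (hHF.2 (n - 1) (by omega)).2 ⟨_, hF (n - 1) (by omega), hFlt _ (by omega)⟩
    omega
  have hVn : V (F n) (r 0) = n := by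
    obtain ⟨k, rfl⟩ : ∃ k, n = k + 1 := ⟨n - 1, by omega⟩
    obtain ⟨-, -, -, h1, -⟩ := iterate_skel_succ (hF (k + 1) le_rfl)
    exact ((hV _ hFW).2 k (by omega)).2 h1
  have hV0 : V' (F n) (r 0) = 0 := by
    by_contra hcon
    obtain ⟨k, hk⟩ := Nat.exists_eq_succ_of_ne_zero hcon
    have hkn := (hV' _ hFW).1
    obtain ⟨b', hb', h1⟩ := exists_of_mem_act_iterate (((hV' _ hFW).2 k (by omega)).1 hk)
    rw [hFn] at h1
    have := hinj' _ _ _ h1 htop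
    omega
  have hrow : ∀ a < W, a ≠ F n → (a, r 0) ∉ S' := by
    intro a ha hne hmem
    have := htop.symm.trans ((hw' _ _).2 ⟨hmem, ha⟩)
    rw [Option.some.injEq] at this
    omega
  have hrow' : ∀ a < W, F n < a → (a, r 0) ∉ S := by
    intro a ha hlt hmem
    have h1 := (hF 0 (by omega)).symm.trans ((hw _ _).2 ⟨hmem, ha⟩)
    rw [Option.some.injEq] at h1
    have := hFlt 0 (by omega)
    omega
  have hH0 : ∀ a ≤ F n, H' a (r 0) = 0 := by
    intro a
    induction a with
    | zero => intro _; exact hC'.horiz_zero _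
    | succ a ih =>
      intro ha
      rw [hC'.horiz_succ, ih (by omega), zero_out (hrow a (by omega) (by omega))]
  have hcell : V (F n) (r 0 + 1) = 1 ∧ H (F n + 1) (r 0) = 1 := by
    rw [hC.vert_succ, hC.horiz_succ, hHn, hVn]
    unfold out
    split_ifs <;> omega
  have hcell' : V' (F n) (r 0 + 1) = 1 ∧ H' (F n + 1) (r 0) = 1 := by
    have : (F n, r 0) ∈ S' := by
      rw [hFn]
      exact ((hw' _ _).1 htop).1
    rw [hC'.vert_succ, hC'.horiz_succ, hH0 _ le_rfl, hV0]
    simp [out, this]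
  -- Right of `F n` neither placement has a rook in this row, and the tableaux below it agree on
  -- these columns because every `F j` is at most `F n`.
  have hright : ∀ a, F n + 1 ≤ a → a ≤ W → H a (r 0) = H' a (r 0) ∧
      ∀ a', F n < a' → a' < a → V a' (r 0 + 1) = V' a' (r 0 + 1) := by
    intro a ha
    induction a, ha using Nat.le_induction with
    | base =>
      intro _
      exact ⟨by rw [hcell.2, hcell'.2], fun a' h1 h2 => by omega⟩
    | succ a ha ih =>
      intro haW
      obtain ⟨h1, h2⟩ := ih (by omega)
      have hVV : V a (r 0) = V' a (r 0) := by
        refine (hV a haW).unique (hV' a haW) fun j hj => ?_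
        rw [hact j hj]
        have := hFlt j hj
        have hle : F (j + 1) ≤ F n := by
          rcases (show j + 1 ≤ n from hj).lt_or_eq with hj' | hj'
          · exact (hFlt _ hj').le
          · rw [hj']
        constructor
        · exact fun h => Or.inr ⟨h, by omega⟩
        · rintro (h | h)
          · omega
          · exact h.1
      have e1 := hrow a haW (by omega)
      have e2 := hrow' a haW (by omega)
      refine ⟨?_, fun a' k1 k2 => ?_⟩
      · rw [hC.horiz_succ, hC'.horiz_succ, h1, hVV]
        simp only [out, e1, e2]
      · rcases (Nat.lt_succ_iff.1 k2).lt_or_eq with k2 | rfl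
        · exact h2 a' k1 k2
        · rw [hC.vert_succ, hC'.vert_succ, h1, hVV]
          simp only [out, e1, e2]
  refine ⟨fun b hb => ?_, fun a ha => ?_⟩
  · rcases hb.lt_or_eq with hb | rfl
    · exact hlow b hb
    · exact (hright W hFW le_rfl).1
  · rcases lt_trichotomy a (F n) with hlt | rfl | hlt
    -- Left of `F n` the moved placement leaves row `r 0` uncoloured, and its tableau below that row
    -- already is the one the original placement reaches by inserting `c 0`.
    · rw [hC'.vert_succ, hH0 a hlt.le, out_zero (hrow a ha hlt.ne)]
      refine (hVF a hlt).unique (hV' a ha) fun j hj => ?_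
      rw [mem_act_succ, hact j hj, hF j hj.le, ← Function.iterate_succ_apply' RookWord.skel j w]
      have := hF (j + 1) hj
      rw [this]
      simp only [Option.some.injEq, ne_eq]
      grind
    · rw [hcell.1, hcell'.1]
    · exact (hright W hFW le_rfl).2 a hlt ha

theorem IsColoring.swap (hC : IsColoring n S V H) :
    IsColoring n (S.image Prod.swap) (fun a b => H b a) (fun a b => V b a) := by
  have h : ∀ a b, (a, b) ∈ S.image Prod.swap ↔ (b, a) ∈ S := by
    intro a b
    simp
  constructor
  · exact hC.horiz_zero
  · exact hC.vert_zero
  · intro a b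
    rw [hC.horiz_succ]
    simp only [out, h]
  · intro a b
    rw [hC.vert_succ]
    simp only [out, h]

theorem IsColoring.unique (hC : IsColoring n S V H) (hC' : IsColoring n S V' H') (a b : ℕ) :
    V a b = V' a b ∧ H a b = H' a b := by
  induction b generalizing a with
  | zero =>
    refine ⟨by rw [hC.vert_zero, hC'.vert_zero], ?_⟩
    induction a with
    | zero => rw [hC.horiz_zero, hC'.horiz_zero]
    | succ a ih => rw [hC.horiz_succ, hC'.horiz_succ, ih, hC.vert_zero, hC'.vert_zero]
  | succ b ihb =>
    have hv : ∀ a, V a (b + 1) = V' a (b + 1) := fun a => by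
      rw [hC.vert_succ, hC'.vert_succ, (ihb a).1, (ihb a).2]
    refine ⟨hv a, ?_⟩
    induction a with
    | zero => rw [hC.horiz_zero, hC'.horiz_zero]
    | succ a ih => rw [hC.horiz_succ, hC'.horiz_succ, ih, hv]

end RookWord

/-! ### Colourings on a Ferrers board -/

namespace RookWord

theorem Chain.exists_seq {w : ℕ → Option ℕ} {m a b : ℕ} (h : Chain w m a b) :
    ∃ c r : ℕ → ℕ, c 0 = a ∧ r 0 = b ∧ (∀ i ≤ m, w (r i) = some (c i)) ∧
      ∀ i < m, c i < c (i + 1) ∧ r (i + 1) < r i := by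
  induction m generalizing a b with
  | zero =>
    refine ⟨fun _ => a, fun _ => b, rfl, rfl, fun _ _ => h, fun i hi => by omega⟩
  | succ m ih =>
    obtain ⟨h0, a', b', ha, hb, h1⟩ := h
    obtain ⟨c, r, rfl, rfl, h2, h3⟩ := ih h1
    refine ⟨fun i => i.casesOn a c, fun i => i.casesOn b r, rfl, rfl, ?_, ?_⟩
    · rintro (_ | i) hi
      · exact h0
      · exact h2 i (by omega)
    · rintro (_ | i) hi
      · exact ⟨ha, hb⟩
      · exact h3 i (by omega)

theorem Chain.of_iterate_skel {w : ℕ → Option ℕ} (hw : Inj w) {j l g b : ℕ}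
    (h : Chain (skel^[j] w) l g b) : ∃ c, Chain w (l + j) c b := by
  induction j generalizing w with
  | zero => exact ⟨g, h⟩
  | succ j ih =>
    obtain ⟨c, hc⟩ := ih hw.skel h
    obtain ⟨d, hd, hdc, g', b', hg, hb, h'⟩ := hc.of_skel hw
    exact ⟨d, hd, g', b', by omega, hb, h'⟩

theorem exists_isWord {S : Finset (ℕ × ℕ)} (hS : ∀ x ∈ S, ∀ y ∈ S, x.2 = y.2 → x = y) (W : ℕ) :
    ∃ w, IsWord S W w := by
  have : ∀ b, ∃ o : Option ℕ, ∀ a, o = some a ↔ (a, b) ∈ S ∧ a < W := by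
    intro b
    by_cases h : ∃ a, (a, b) ∈ S ∧ a < W
    · obtain ⟨a, ha⟩ := h
      refine ⟨some a, fun a' => ⟨?_, fun h' => ?_⟩⟩
      · rintro ⟨⟩
        exact ha
      · have := hS _ ha.1 _ h'.1 rfl
        simpa using this
    · refine ⟨none, fun a' => ⟨?_, fun h' => (h ⟨a', h'⟩).elim⟩⟩
      rintro ⟨⟩
  choose w h using this
  exact ⟨w, fun a b => h b a⟩

theorem IsWord.inj {S : Finset (ℕ × ℕ)} (hS : ∀ x ∈ S, ∀ y ∈ S, x.1 = y.1 → x = y) {W : ℕ}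
    {w : ℕ → Option ℕ} (hw : IsWord S W w) : Inj w := by
  intro a b b' h h'
  have := hS _ ((hw _ _).1 h).1 _ ((hw _ _).1 h').1 rfl
  simpa using this

variable {n : ℕ} {S : Finset (ℕ × ℕ)} {V H : ℕ → ℕ → ℕ}

theorem IsColoring.le (hn : 1 ≤ n) (hC : IsColoring n S V H) (a b : ℕ) :
    V a b ≤ n ∧ H a b ≤ n := by
  have key : ∀ (p : Prop) [Decidable p] (v h : ℕ), v ≤ n → out n p v h ≤ n := by
    intro p _ v h hv
    unfold out; split_ifs <;> omega
  constructor
  · induction b with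
    | zero => rw [hC.vert_zero]; omega
    | succ b ih => rw [hC.vert_succ]; exact key _ _ _ ih
  · induction a with
    | zero => rw [hC.horiz_zero]; omega
    | succ a ih => rw [hC.horiz_succ]; exact key _ _ _ ih

theorem IsColoring.exists_of_vert (hC : IsColoring n S V H) {a b : ℕ} (h : V a b ≠ 0) :
    ∃ b' < b, (a, b') ∈ S := by
  induction b with
  | zero => exact absurd (hC.vert_zero a) h
  | succ b ih =>
    by_cases h0 : (a, b) ∈ S
    · exact ⟨b, b.lt_succ_self, h0⟩
    · by_cases hv : V a b = 0
      · rw [hC.vert_succ, hv, zero_out h0] at h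
        exact absurd rfl h
      · obtain ⟨b', hb', h'⟩ := ih hv
        exact ⟨b', by omega, h'⟩

theorem IsColoring.exists_of_horiz (hC : IsColoring n S V H) {a b : ℕ} (h : H a b ≠ 0) :
    ∃ a' < a, (a', b) ∈ S := by
  obtain ⟨a', ha', h'⟩ := hC.swap.exists_of_vert h
  exact ⟨a', ha', by simpa using h'⟩

/-- Unequal outgoing colours passed unchanged, 0 and 0 came from an empty square, 1 and 1 from a
rook, and a common colour t ≥ 2 from t - 1. Only the wrap could also produce 1 and 1. -/
theorem out_injective {v h v' h' : ℕ} {p p' : Prop} [Decidable p] [Decidable p']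
    (hv : v ≤ n) (hv' : v' ≤ n) (hp : p → v = 0 ∧ h = 0) (hp' : p' → v' = 0 ∧ h' = 0)
    (hn : ¬ (v = n ∧ h = n)) (hn' : ¬ (v' = n ∧ h' = n))
    (h1 : out n p v h = out n p' v' h') (h2 : out n p h v = out n p' h' v') :
    v = v' ∧ h = h' ∧ (p ↔ p') := by
  by_cases k : p
  · obtain ⟨rfl, rfl⟩ := hp k
    by_cases k' : p'
    · obtain ⟨rfl, rfl⟩ := hp' k'
      exact ⟨rfl, rfl, iff_of_true k k'⟩
    · simp only [out, k, k', if_true, if_false] at h1 h2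
      split_ifs at h1 h2 <;> omega
  · by_cases k' : p'
    · obtain ⟨rfl, rfl⟩ := hp' k'
      simp only [out, k, k', if_true, if_false] at h1 h2
      split_ifs at h1 h2 <;> omega
    · clear hp hp'
      simp only [out, k, k', if_false, iff_self, and_true] at h1 h2 ⊢
      split_ifs at h1 h2 <;> omega

/-- On the board `F` the sets `S` and `S'` lead to the same colours on the boundary. -/
def BoundaryEq (n : ℕ) (F : YoungDiagram) (S S' : Finset (ℕ × ℕ)) : Prop :=
  ∀ V H V' H', IsColoring n S V H → IsColoring n S' V' H' →
    (∀ a, V a (F.rowLen a) = V' a (F.rowLen a)) ∧ ∀ b, H (F.colLen b) b = H' (F.colLen b) b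

theorem BoundaryEq.refl (n : ℕ) (F : YoungDiagram) (S : Finset (ℕ × ℕ)) : BoundaryEq n F S S :=
  fun _ _ _ _ h h' => ⟨fun _ => (h.unique h' _ _).1, fun _ => (h.unique h' _ _).2⟩

theorem BoundaryEq.symm {F : YoungDiagram} {S S' : Finset (ℕ × ℕ)} (h : BoundaryEq n F S S') :
    BoundaryEq n F S' S :=
  fun V H V' H' k k' => ⟨fun a => ((h V' H' V H k' k).1 a).symm,
    fun b => ((h V' H' V H k' k).2 b).symm⟩

theorem BoundaryEq.trans {F : YoungDiagram} {S S' S'' : Finset (ℕ × ℕ)}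
    (h : BoundaryEq n F S S') (h' : BoundaryEq n F S' S'') : BoundaryEq n F S S'' := by
  intro V H V'' H'' k k''
  obtain ⟨V', H', k'⟩ := exists_isColoring n S'
  obtain ⟨h1, h2⟩ := h _ _ _ _ k k'
  obtain ⟨h3, h4⟩ := h' _ _ _ _ k' k''
  exact ⟨fun a => (h1 a).trans (h3 a), fun b => (h2 b).trans (h4 b)⟩

theorem BoundaryEq.swap {F : YoungDiagram} {S S' : Finset (ℕ × ℕ)} (h : BoundaryEq n F S S') :
    BoundaryEq n F.transpose (S.image Prod.swap) (S'.image Prod.swap) := by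
  intro V H V' H' k k'
  have hs : ∀ T : Finset (ℕ × ℕ), (T.image Prod.swap).image Prod.swap = T := fun T => by
    rw [Finset.image_image]; simp
  have k1 := k.swap
  have k1' := k'.swap
  rw [hs] at k1 k1'
  obtain ⟨h1, h2⟩ := h _ _ _ _ k1 k1'
  simp only [YoungDiagram.rowLen_transpose, YoungDiagram.colLen_transpose]
  exact ⟨h2, h1⟩

/-- Outside the rectangle `[0, W) × [0, R]`, whose northeast square is maximal in its row of `F`,
equal rooks propagate equal colours. -/
theorem boundaryEq_of_rectangle {F : YoungDiagram} {S S' : Finset (ℕ × ℕ)} {R : ℕ}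
    {V H V' H' : ℕ → ℕ → ℕ} (hC : IsColoring n S V H) (hC' : IsColoring n S' V' H')
    (hS : ∀ a b, F.colLen R ≤ a ∨ R < b → ((a, b) ∈ S ↔ (a, b) ∈ S'))
    (hH : ∀ b ≤ R, H (F.colLen R) b = H' (F.colLen R) b)
    (hV : ∀ a < F.colLen R, V a (R + 1) = V' a (R + 1)) :
    (∀ a, V a (F.rowLen a) = V' a (F.rowLen a)) ∧
      ∀ b, H (F.colLen b) b = H' (F.colLen b) b := by
  have hright : ∀ b ≤ R, ∀ a, F.colLen R ≤ a → V a b = V' a b ∧ H a b = H' a b := by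
    have aux : ∀ b ≤ R, (∀ a, F.colLen R ≤ a → V a b = V' a b) →
        ∀ a, F.colLen R ≤ a → H a b = H' a b := by
      intro b hb hv a ha
      induction a, ha using Nat.le_induction with
      | base => exact hH b hb
      | succ a ha ih =>
        rw [hC.horiz_succ, hC'.horiz_succ, ih, hv a ha]
        simp only [out, hS a b (Or.inl ha)]
    intro b hb
    have hv : ∀ a, F.colLen R ≤ a → V a b = V' a b := by
      induction b with
      | zero => intro a _; rw [hC.vert_zero, hC'.vert_zero]
      | succ b ih =>
        intro a ha
        rw [hC.vert_succ, hC'.vert_succ, ih (by omega) a ha,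
          aux b (by omega) (ih (by omega)) a ha]
        simp only [out, hS a b (Or.inl ha)]
    exact fun a ha => ⟨hv a ha, aux b hb hv a ha⟩
  have habove : ∀ b, R + 1 ≤ b →
      (∀ a < F.colLen R, V a b = V' a b) ∧ ∀ a ≤ F.colLen R, H a b = H' a b := by
    have aux : ∀ b, R + 1 ≤ b → (∀ a < F.colLen R, V a b = V' a b) →
        ∀ a ≤ F.colLen R, H a b = H' a b := by
      intro b hb hv a
      induction a with
      | zero => intro _; rw [hC.horiz_zero, hC'.horiz_zero]
      | succ a ih =>
        intro ha
        rw [hC.horiz_succ, hC'.horiz_succ, ih (by omega), hv a ha]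
        simp only [out, hS a b (Or.inr hb)]
    intro b hb
    have hv : ∀ a < F.colLen R, V a b = V' a b := by
      induction b, hb using Nat.le_induction with
      | base => exact hV
      | succ b hb ih =>
        intro a ha
        rw [hC.vert_succ, hC'.vert_succ, ih a ha, aux b hb ih a ha.le]
        simp only [out, hS a b (Or.inr hb)]
    exact ⟨hv, aux b hb hv⟩
  constructor
  · intro a
    rcases lt_or_ge a (F.colLen R) with ha | ha
    · have h1 := YoungDiagram.mem_iff_lt_rowLen.1 (YoungDiagram.mem_iff_lt_colLen.2 ha)
      exact (habove _ h1).1 a ha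
    · have h1 : ¬ R < F.rowLen a := fun h =>
        absurd (YoungDiagram.mem_iff_lt_colLen.1 (YoungDiagram.mem_iff_lt_rowLen.2 h))
          (not_lt.2 ha)
      exact (hright _ (not_lt.1 h1) a ha).1
  · intro b
    rcases le_or_gt b R with hb | hb
    · exact (hright b hb _ (F.colLen_anti _ _ hb)).2
    · exact (habove b hb).2 _ (F.colLen_anti _ _ hb.le)

end RookWord

/-! ### Avoiding placements are determined by their boundary colours -/

namespace RookPlacement

open RookWord

variable {F : YoungDiagram} {n : ℕ}

theorem isOccurrence_of_seq (P : RookPlacement F) {c r : ℕ → ℕ}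
    (hmem : ∀ i ≤ n, (c i, r i) ∈ P.squares)
    (hlt : ∀ i < n, c i < c (i + 1) ∧ r (i + 1) < r i) (hF : (c n, r 0) ∈ F) :
    P.IsOccurrence fun i : Fin (n + 1) => (c i, r i) := by
  have hmono : ∀ i j, i < j → j ≤ n → c i < c j ∧ r j < r i := by
    intro i j hij
    induction j, hij using Nat.le_induction with
    | base => exact fun h => hlt i h
    | succ j hij ih =>
      intro h
      have h1 := ih (by omega)
      have h2 := hlt j h
      omega
  refine ⟨fun i => hmem i (by omega), fun i j hij => (hmono i j hij (by omega)).1,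
    fun i j hij => (hmono i j hij (by omega)).2, (0, 0), (c n, r 0), ?_, ?_⟩
  · intro x hx
    exact F.up_left_mem hx.2.1 hx.2.2 hF
  · intro i
    have hi : (i : ℕ) ≤ n := by omega
    refine ⟨⟨Nat.zero_le _, Nat.zero_le _⟩, ?_, ?_⟩
    · rcases hi.lt_or_eq with h | h
      · exact (hmono i n h le_rfl).1.le
      · exact (congrArg c h).le
    · rcases Nat.eq_zero_or_pos i with h | h
      · exact (congrArg r h).le
      · exact (hmono 0 i h hi).2.le

/-- A wrap means that a column is bumped out of tableau row `n`, which requires a chain of `n + 1`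
rooks weakly below and to the left of `(a, b)`. That rectangle lies in the board, so the chain is an
occurrence. -/
theorem not_wrap (hn : 1 ≤ n) {P : RookPlacement F} (hP : P.Avoids (n + 1))
    {V H : ℕ → ℕ → ℕ} (hC : IsColoring n P.squares V H) {a b : ℕ} (hF : (a, b) ∈ F) :
    ¬ (V a b = n ∧ H a b = n) := by
  obtain ⟨w, hw⟩ := exists_isWord P.row_unique (a + 1)
  have hinj := hw.inj P.col_unique
  have hnone : ∀ b' < b + 1, skel^[n] w b' = none := by
    intro b' hb'
    by_contra hcon
    obtain ⟨g, hg⟩ := Option.ne_none_iff_exists'.1 hcon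
    obtain ⟨d, hd⟩ := Chain.of_iterate_skel (l := 0) hinj hg
    rw [zero_add] at hd
    obtain ⟨c, r, -, hr0, h1, h2⟩ := hd.exists_seq
    refine hP ⟨_, P.isOccurrence_of_seq (fun i hi => ((hw _ _).1 (h1 i hi)).1) h2 ?_⟩
    refine F.up_left_mem ?_ (hr0.le.trans (Nat.lt_succ_iff.1 hb')) hF
    exact Nat.lt_succ_iff.1 ((hw _ _).1 (h1 n le_rfl)).2
  intro hcon
  have h1 := vertSpec_of_none hinj hn hw hC hnone b.le_succ a a.lt_succ_self
  have h2 := horizSpec_of_none hinj hn hw hC hnone b.lt_succ_self a.le_succ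
  have h3 := hnone b b.lt_succ_self
  rw [(bumped_iff h1 h2 (by simp [h3]) le_rfl).2 (Or.inr ⟨by omega, hcon⟩)] at h3
  cases h3

theorem rook_imp (P : RookPlacement F) {V H : ℕ → ℕ → ℕ} (hC : IsColoring n P.squares V H)
    {a b : ℕ} (h : (a, b) ∈ P.squares) : V a b = 0 ∧ H a b = 0 := by
  constructor
  · by_contra hcon
    obtain ⟨b', hb', h'⟩ := hC.exists_of_vert hcon
    have := P.col_unique _ h _ h' rfl
    rw [Prod.mk.injEq] at this
    omega
  · by_contra hcon
    obtain ⟨b', hb', h'⟩ := hC.exists_of_horiz hcon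
    have := P.row_unique _ h _ h' rfl
    rw [Prod.mk.injEq] at this
    omega

/-- A placement that avoids `k … 1` is determined by the colours on the boundary. -/
theorem eq_of_boundaryEq (hn : 1 ≤ n) {P Q : RookPlacement F} (hP : P.Avoids (n + 1))
    (hQ : Q.Avoids (n + 1)) (h : BoundaryEq n F P.squares Q.squares) : P = Q := by
  obtain ⟨V, H, hC⟩ := exists_isColoring n P.squares
  obtain ⟨V', H', hC'⟩ := exists_isColoring n Q.squares
  obtain ⟨hV, hH⟩ := h _ _ _ _ hC hC'
  have cell : ∀ a b, (a, b) ∈ F → V a (b + 1) = V' a (b + 1) → H (a + 1) b = H' (a + 1) b →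
      V a b = V' a b ∧ H a b = H' a b ∧ ((a, b) ∈ P.squares ↔ (a, b) ∈ Q.squares) := by
    intro a b hF h1 h2
    rw [hC.vert_succ, hC'.vert_succ] at h1
    rw [hC.horiz_succ, hC'.horiz_succ] at h2
    exact out_injective (hC.le hn a b).1 (hC'.le hn a b).1 (P.rook_imp hC) (Q.rook_imp hC')
      (not_wrap hn hP hC hF) (not_wrap hn hQ hC' hF) h1 h2
  -- Induction on the distance to the boundary: a step up or to the right inside the board decreases
  -- it. The bounds on `b` and `a` select the line segments that lie in the board or on its
  -- boundary.
  have key : ∀ d a b, (F.rowLen a - b) + (F.colLen b - a) = d →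
      (b ≤ F.rowLen a → V a b = V' a b) ∧ (a ≤ F.colLen b → H a b = H' a b) := by
    intro d
    induction d using Nat.strong_induction_on with
    | _ d ih =>
      intro a b hd
      by_cases hF : (a, b) ∈ F
      · have h1 := YoungDiagram.mem_iff_lt_rowLen.1 hF
        have h2 := YoungDiagram.mem_iff_lt_colLen.1 hF
        have h3 := F.colLen_anti b (b + 1) (by omega)
        have h4 := F.rowLen_anti a (a + 1) (by omega)
        have h5 := cell a b hF ((ih _ (by omega) a (b + 1) rfl).1 h1)
          ((ih _ (by omega) (a + 1) b rfl).2 h2)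
        exact ⟨fun _ => h5.1, fun _ => h5.2.1⟩
      · have h1 : ¬ b < F.rowLen a := fun h => hF (YoungDiagram.mem_iff_lt_rowLen.2 h)
        have h2 : ¬ a < F.colLen b := fun h => hF (YoungDiagram.mem_iff_lt_colLen.2 h)
        constructor
        · intro h
          rw [le_antisymm h (not_lt.1 h1)]
          exact hV a
        · intro h
          rw [le_antisymm h (not_lt.1 h2)]
          exact hH b
  have hmem : ∀ a b, (a, b) ∈ F → ((a, b) ∈ P.squares ↔ (a, b) ∈ Q.squares) := fun a b hF =>
    (cell a b hF ((key _ a (b + 1) rfl).1 (YoungDiagram.mem_iff_lt_rowLen.1 hF))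
      ((key _ (a + 1) b rfl).2 (YoungDiagram.mem_iff_lt_colLen.1 hF))).2.2
  apply RookPlacement.ext
  ext ⟨a, b⟩
  exact ⟨fun h => (hmem a b ((YoungDiagram.mem_cells _).1 (P.subset h))).1 h,
    fun h => (hmem a b ((YoungDiagram.mem_cells _).1 (Q.subset h))).2 h⟩

theorem Avoids.inverse {k : ℕ} {P : RookPlacement F} (hP : P.Avoids k) :
    P.inverse.Avoids k := by
  rintro ⟨s, hs⟩
  refine hP ⟨fun i => (s i.rev).swap, fun i => ?_, fun i j hij => ?_, fun i j hij => ?_, ?_⟩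
  · obtain ⟨x, hx, h⟩ := Finset.mem_image.1 (hs.mem i.rev)
    rw [← h, Prod.swap_swap]
    exact hx
  · exact hs.row_gt _ _ (Fin.rev_lt_rev.2 hij)
  · exact hs.col_lt _ _ (Fin.rev_lt_rev.2 hij)
  · obtain ⟨p, q, h1, h2⟩ := hs.rect
    refine ⟨p.swap, q.swap, fun x hx => ?_, fun i => ?_⟩
    · have := h1 x.swap ⟨⟨hx.1.2, hx.1.1⟩, ⟨hx.2.2, hx.2.1⟩⟩
      rwa [YoungDiagram.mem_transpose, Prod.swap_swap] at this
    · have := h2 i.rev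
      exact ⟨⟨this.1.2, this.1.1⟩, ⟨this.2.2, this.2.1⟩⟩

theorem IsSmallestOccurrence.not_lt {P : RookPlacement F} {k : ℕ} {s t : Fin k → ℕ × ℕ}
    (hs : P.IsSmallestOccurrence s) (ht : P.IsOccurrence t) (i : Fin k)
    (heq : ∀ j < i, (t j).2 = (s j).2) : ¬ (t i).2 < (s i).2 := fun hlt =>
  (hs.2 t ht).not_gt ⟨i, heq, hlt⟩

end RookPlacement

/-! ### Invariance of the boundary colours under φ, and conclusion -/

namespace RookPlacement

open RookWord

variable {F : YoungDiagram} {n : ℕ}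

/-- The word uses only columns that reach row `r 0`, so any of its chains starting no higher than
that row lies in a rectangle of the board. A chain violating a greedy condition thus yields a
lexicographically smaller occurrence. -/
theorem IsSmallestOccurrence.greedy {P : RookPlacement F} {c r : ℕ → ℕ} {w : ℕ → Option ℕ}
    (hs : P.IsSmallestOccurrence fun i : Fin (n + 1) => (c i, r i))
    (hw : IsWord P.squares (F.colLen (r 0)) w) (hF : (c n, r 0) ∈ F) : Greedy w n c r := by
  have hcol : ∀ i j, i < j → j ≤ n → c i < c j := fun i j hij hj =>
    hs.1.col_lt ⟨i, by omega⟩ ⟨j, by omega⟩ hij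
  have hrow : ∀ i j, i < j → j ≤ n → r j < r i := fun i j hij hj =>
    hs.1.row_gt ⟨i, by omega⟩ ⟨j, by omega⟩ hij
  have hmem : ∀ i ≤ n, (c i, r i) ∈ P.squares := fun i hi => hs.1.mem ⟨i, by omega⟩
  have hcW : ∀ i ≤ n, c i < F.colLen (r 0) := by
    intro i hi
    have := YoungDiagram.mem_iff_lt_colLen.1 hF
    rcases hi.lt_or_eq with h | rfl
    · exact (hcol i n h le_rfl).trans this
    · exact this
  refine ⟨hw.inj P.col_unique, fun i hi => (hw _ _).2 ⟨hmem i hi, hcW i hi⟩,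
    fun i hi => hcol _ _ i.lt_succ_self hi, fun i hi => hrow _ _ i.lt_succ_self hi, ?_, ?_⟩
  · intro a b hab
    obtain ⟨c', r', -, rfl, h1, h2⟩ := hab.exists_seq
    by_contra hcon
    have hocc := P.isOccurrence_of_seq (fun i hi => ((hw _ _).1 (h1 i hi)).1) h2
      (F.up_left_mem le_rfl (by omega)
        (YoungDiagram.mem_iff_lt_colLen.2 ((hw _ _).1 (h1 n le_rfl)).2))
    exact hs.not_lt hocc 0 (fun j hj => absurd hj (Fin.not_lt_zero j)) (not_le.1 hcon)
  · intro i l a b hil hab hia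
    obtain ⟨c', r', rfl, rfl, h1, h2⟩ := hab.exists_seq
    by_contra hcon
    have hri := hrow i (i + 1) i.lt_succ_self (by omega)
    -- The competing occurrence keeps the rooks `0, …, i` and continues with the lower chain.
    have hocc := P.isOccurrence_of_seq (n := n)
      (c := fun j => if j ≤ i then c j else c' (j - (i + 1)))
      (r := fun j => if j ≤ i then r j else r' (j - (i + 1))) ?_ ?_ ?_
    · refine hs.not_lt hocc ⟨i + 1, by omega⟩ (fun j hj => ?_) ?_
      · exact if_pos (Nat.lt_succ_iff.1 hj)
      · simpa using hcon
    · intro j hj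
      split_ifs with h
      · exact hmem j hj
      · exact ((hw _ _).1 (h1 _ (by omega))).1
    · intro j hj
      rcases lt_trichotomy j i with h | rfl | h
      · rw [if_pos h.le, if_pos h.le, if_pos (by omega), if_pos (by omega)]
        exact ⟨hcol _ _ j.lt_succ_self hj, hrow _ _ j.lt_succ_self hj⟩
      · rw [if_pos le_rfl, if_pos le_rfl, if_neg (by omega), if_neg (by omega), Nat.sub_self]
        exact ⟨hia, by omega⟩
      · rw [if_neg (by omega), if_neg (by omega), if_neg (by omega), if_neg (by omega),
          show j + 1 - (i + 1) = j - (i + 1) + 1 by omega]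
        exact h2 _ (by omega)
    · rw [if_neg (by omega), if_pos (Nat.zero_le _)]
      exact YoungDiagram.mem_iff_lt_colLen.2 ((hw _ _).1 (h1 _ (by omega))).2

/-- The cyclic move along the smallest occurrence preserves the colours on the boundary. -/
theorem boundaryEq_move (hn : 1 ≤ n) (P : RookPlacement F) {s : Fin (n + 1) → ℕ × ℕ}
    (hs : P.IsSmallestOccurrence s) :
    BoundaryEq n F P.squares (P.move s hs.1).squares := by
  obtain ⟨c, r, rfl⟩ : ∃ c r : ℕ → ℕ, s = fun i : Fin (n + 1) => (c i, r i) := by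
    refine ⟨fun i => (s (Fin.ofNat (n + 1) i)).1, fun i => (s (Fin.ofNat (n + 1) i)).2, ?_⟩
    funext i
    simp
  have hF : (c n, r 0) ∈ F := by
    obtain ⟨p, q, h1, h2⟩ := hs.1.rect
    have k1 := h2 (Fin.last n)
    have k2 := h2 0
    exact h1 _ ⟨⟨k1.1.1, k2.1.2⟩, ⟨k1.2.1, k2.2.2⟩⟩
  have hrot : ∀ i : Fin (n + 1), (i : ℕ) < n → ((finRotate (n + 1) i : Fin (n + 1)) : ℕ) = i + 1 :=
    fun i hi => by
      have : i = ⟨i, by omega⟩ := rfl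
      rw [this, finRotate_of_lt hi]
  have hmem := P.mem_movedSquares fun i : Fin (n + 1) => (c i, r i)
  set Q := P.move _ hs.1 with hQ
  change ∀ x, x ∈ Q.squares ↔ _ at hmem
  obtain ⟨w, hw⟩ := exists_isWord P.row_unique (F.colLen (r 0))
  obtain ⟨w', hw'⟩ := exists_isWord Q.row_unique (F.colLen (r 0))
  have hG := hs.greedy hw hF
  have hcW : ∀ i ≤ n, c i < F.colLen (r 0) := fun i hi => ((hw _ _).1 (hG.eq_some i hi)).2
  have hrR : ∀ i ≤ n, r i ≤ r 0 := fun i hi => by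
    rcases Nat.eq_zero_or_pos i with rfl | h
    · exact le_rfl
    · exact (hG.row_anti h hi).le
  have hsame : ∀ a b, (∀ i ≤ n, r i ≠ b) → ((a, b) ∈ P.squares ↔ (a, b) ∈ Q.squares) := by
    intro a b h
    rw [hmem]
    constructor
    · exact fun h' => Or.inl ⟨h', fun i hi => h i (by omega) (congrArg Prod.snd hi)⟩
    · rintro (h' | ⟨i, hi⟩)
      · exact h'.1
      · exact absurd (congrArg Prod.snd hi) (h _ (by omega))
  have hsame' : ∀ a b, (∀ i ≤ n, c i ≠ a) → ((a, b) ∈ P.squares ↔ (a, b) ∈ Q.squares) := by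
    intro a b h
    rw [hmem]
    constructor
    · exact fun h' => Or.inl ⟨h', fun i hi => h i (by omega) (congrArg Prod.fst hi)⟩
    · rintro (h' | ⟨i, hi⟩)
      · exact h'.1
      · exact absurd (congrArg Prod.fst hi) (h _ (by omega))
  have hS : Shift w w' n c r := by
    constructor
    · intro i hi
      refine (hw' _ _).2 ⟨(hmem _).2 (Or.inr ⟨⟨i, by omega⟩, ?_⟩), hcW i hi.le⟩
      simp only [hrot ⟨i, by omega⟩ hi]
    · intro b hb hne
      refine Option.ext fun a => ?_
      rw [hw' a b, hw a b, hsame a b]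
      rintro (_ | i) hi rfl
      · exact lt_irrefl _ hb
      · exact hne i hi rfl
  have htop : w' (r 0) = some (c n) := by
    refine (hw' _ _).2 ⟨(hmem _).2 (Or.inr ⟨Fin.last n, ?_⟩), hcW n le_rfl⟩
    rw [finRotate_last]
    rfl
  intro V H V' H' hC hC'
  obtain ⟨h1, h2⟩ := hG.coloring_eq hn hS (hw'.inj Q.col_unique) hw hw' htop hC hC'
  refine boundaryEq_of_rectangle hC hC' (fun a b hab => ?_) h1 h2
  rcases hab with h | h
  · exact hsame' a b fun i hi => ((hcW i hi).trans_le h).ne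
  · exact hsame a b fun i hi => ((hrR i hi).trans_lt h).ne

theorem boundaryEq_phi (hn : 1 ≤ n) (P : RookPlacement F) :
    BoundaryEq n F P.squares (phi (n + 1) P).squares := by
  unfold phi
  split_ifs with h
  · exact BoundaryEq.refl _ _ _
  · exact P.boundaryEq_move hn (P.exists_isSmallestOccurrence h).choose_spec

theorem boundaryEq_phiStar (hn : 1 ≤ n) (hk : 2 ≤ n + 1) (P : RookPlacement F) :
    BoundaryEq n F P.squares (phiStar (n + 1) hk P).squares := by
  have key : ∀ m, BoundaryEq n F P.squares ((phi (n + 1))^[m] P).squares := by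
    intro m
    induction m with
    | zero => exact BoundaryEq.refl _ _ _
    | succ m ih =>
      rw [Function.iterate_succ_apply']
      exact ih.trans (boundaryEq_phi hn _)
  exact key _

theorem avoids_phiStar {k : ℕ} (hk : 2 ≤ k) (P : RookPlacement F) :
    (phiStar k hk P).Avoids k := by
  classical
  exact Nat.find_spec (exists_avoids_iterate hk P)

end RookPlacement

theorem mainTheorem2 (k : ℕ) (hk : 2 ≤ k) (F : YoungDiagram) (P : RookPlacement F) :
    RookPlacement.phiStar k hk P.inverse = (RookPlacement.phiStar k hk P).inverse := by
  obtain ⟨n, rfl⟩ : ∃ n, k = n + 1 := ⟨k - 1, by omega⟩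
  have hn : 1 ≤ n := by omega
  exact RookPlacement.eq_of_boundaryEq hn (RookPlacement.avoids_phiStar hk _)
    (RookPlacement.avoids_phiStar hk P).inverse
    ((RookPlacement.boundaryEq_phiStar hn hk P.inverse).symm.trans
      (RookPlacement.boundaryEq_phiStar hn hk P).swap)
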